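/- **Setting.** A line network has nodes $v_0,\dots,v_L$ in tandem ($L\ge 1$ links). In each time slot $t=1,2,\dots$ one packet is sent over every link; all losses are independent, and a packet sent over link $i$ (from $v_{i-1}$ to $v_i$) is received with probability $p_i\in(0,1]$. The source $v_0$ holds $k$ message vectors over $\mathbb F_2$. In a (random) dense code each packet sent by $v_0$ is a uniformly random $\mathbb F_2$-linear combination of the $k$ message vectors, and each packet sent by an interior node in slot $t$ is a uniformly random $\mathbb F_2$-linear combination of the packets that this node received in slots $s<t$; a code is the family of all coefficients (one for each pair of sent packet and combined packet, packets being labelled by link and slot), and all coefficients are independent and uniform, and independent of the losses. The coding delay is the first time at which the global encoding vectors of the packets received by $v_L$ span $\mathbb F_2^k$. The average coding delay of a code is the expectation of its coding delay over the losses only; it is a random variable through the code. For each $k\in\mathbb N$ let a line network with $L=L(k)\ge1$ links and pairwise distinct parameters $p_1,\dots,p_L\in(0,1]$ (which may depend on $k$), and $\epsilon=\epsilon(k)\in(0,1)$ be given. Assume that either $p_1>p_2>\cdots>p_L$ for every $k$, or the network ($L$ and $p_1,\dots,p_L$, in any order) does not depend on $k$. Put $p=\min_{1\le i\le L}p_i$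 and $\gamma_e=\min_{1<i\le L}|p_i-p_{i-1}|$ (with $\gamma_e=\infty$ if $L=1$), and let $\log=\log_2$. Asymptotic notation refers to $k\to\infty$. **Theorem.** Let $f(k)\to\infty$ with $f(k)=o\!\left(\frac{k}{L\log(kL/\epsilon)}\right)$, let $w=w(k)$ be real with $w\sim\frac{k}{f(k)\log(kL/\epsilon)}$, and suppose that $$w\log\frac{wL}{\epsilon}=o\!\left(\min\Big\{\frac{\gamma_e}{p},1\Big\}\,k\right).$$ Then there is a sequence $\eta(k)\to0$ such that for all sufficiently large $k$ the average coding delay of a random dense code for $k$ message vectors is larger than $$\frac1p\left(k+(1+\eta(k))\frac{kL}{w}\right)$$ with probability (over the code) at most $\epsilon$. -/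

import Mathlib

open MeasureTheory ProbabilityTheory Filter Topology Asymptotics
open scoped ENNReal

/-- A line network: nodes `v_0, …, v_L` in tandem, joined by `L ≥ 1` links.  Link `i : Fin L` goes
from `v_i` to `v_{i+1}`, and a transmission over it succeeds with probability `p i ∈ (0, 1]`. -/
structure LineNetwork where
  L : ℕ
  L_pos : 0 < L
  p : Fin L → ℝ
  p_pos : ∀ i, 0 < p i
  p_le_one : ∀ i, p i ≤ 1

namespace LineNetwork

variable (net : LineNetwork)

/-- `p = min_i p_i`. -/
noncomputable def minParam : ℝ := ⨅ i : Fin net.L, net.p i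

/-- `γ_e = min_{1 < i ≤ L} |p_i - p_{i-1}|`, the minimum over the empty set (`L = 1`) being `∞`. -/
noncomputable def gammaE : ℝ≥0∞ :=
  ⨅ (i : ℕ) (h : i + 1 < net.L),
    ENNReal.ofReal |net.p ⟨i + 1, h⟩ - net.p ⟨i, Nat.lt_of_succ_lt h⟩|

/-- `min {γ_e / p, 1}`. -/
noncomputable def gapRatio : ℝ :=
  (min (net.gammaE / ENNReal.ofReal net.minParam) 1).toReal

/-- A realization of the losses: `τ (i, t)` is `true` iff the packet sent over link `i` in time
slot `t` is received.  Slot `t = 0, 1, 2, …` is the time interval `(t, t + 1]`, and every link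
carries one transmission in every slot. -/
abbrev Traffic : Type := Fin net.L × ℕ → Bool

/-- `p_i` as an element of `[0, 1]`. -/
def prob (i : Fin net.L) : unitInterval := ⟨net.p i, Set.mem_Icc.2 ⟨(net.p_pos i).le, net.p_le_one i⟩⟩

/-- All transmissions succeed independently, those over link `i` with probability `p i`. -/
noncomputable def trafficMeasure : Measure net.Traffic :=
  Measure.infinitePi fun x : Fin net.L × ℕ =>
    bernoulliMeasure true false (net.prob x.1)

/-- Labels of the coefficients that a dense code for `k` message vectors uses.
`source t j`: coefficient of the `j`-th message vector in the packet that `v_0` sends in slot `t`.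
`relay i t s`: coefficient, in the packet sent over link `i` in slot `t`, of the packet that the
starting node of this link received in the earlier slot `s`
(only those with `0 < i` and `s < t` are used). -/
inductive CoeffIndex (k : ℕ) : Type
  | source (t : ℕ) (j : Fin k)
  | relay (i : Fin net.L) (t s : ℕ)

/-- A dense code over `𝔽₂`: a choice of all coefficients. -/
abbrev Code (k : ℕ) : Type := net.CoeffIndex k → ZMod 2

/-- A randomly chosen dense code: independent uniformly distributed coefficients. -/
noncomputable def codeMeasure (k : ℕ) : Measure (net.Code k) :=
  Measure.infinitePi fun _ : net.CoeffIndex k => (PMF.uniformOfFintype (ZMod 2)).toMeasure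

instance : IsProbabilityMeasure net.trafficMeasure := by
  unfold trafficMeasure; infer_instance

instance (k : ℕ) : IsProbabilityMeasure (net.codeMeasure k) := by
  unfold codeMeasure; infer_instance

variable {net} {k : ℕ}

/-- Global encoding vector of the packet sent over link `i` in slot `t`.  The source combines the
message vectors; every other node combines the packets it has received in the slots before `t`. -/
def globalVec (c : net.Code k) (τ : net.Traffic) :
    (i : ℕ) → i < net.L → ℕ → (Fin k → ZMod 2)
  | 0, _, t => fun j => c (.source t j)
  | i + 1, h, t =>
      ∑ s ∈ Finset.range t,
        if τ (⟨i, Nat.lt_of_succ_lt h⟩, s) = true then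
          c (.relay ⟨i + 1, h⟩ t s) • globalVec c τ i (Nat.lt_of_succ_lt h) s
        else 0

/-- Index of the link that enters the sink. -/
def lastLink (net : LineNetwork) : Fin net.L := ⟨net.L - 1, Nat.sub_lt net.L_pos Nat.one_pos⟩

/-- The sink can recover all `k` message vectors at time `n`: the global encoding vectors of the
packets it has received in the first `n` slots span `𝔽₂^k`. -/
def Decodable (c : net.Code k) (τ : net.Traffic) (n : ℕ) : Prop :=
  Submodule.span (ZMod 2)
    {v : Fin k → ZMod 2 | ∃ t < n, τ (lastLink net, t) = true ∧
      v = globalVec c τ (lastLink net) (lastLink net).isLt t} = ⊤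

/-- The coding delay: the first time at which the sink can recover all message vectors
(`∞` if there is none). -/
noncomputable def codingDelay (c : net.Code k) (τ : net.Traffic) : ℝ≥0∞ :=
  ⨅ (n : ℕ) (_ : Decodable c τ n), (n : ℝ≥0∞)

/-- The average coding delay of the code `c`: the coding delay averaged over the traffic only. -/
noncomputable def avgCodingDelay (c : net.Code k) : ℝ≥0∞ :=
  ∫⁻ τ, codingDelay c τ ∂net.trafficMeasure

end LineNetwork

/-! Decoding fails at time n only if some nonzero functional x on 𝔽₂^k kills every vector received
by the sink. Fix x and the losses, and follow the `frontier`, a node known to hold a packet on which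
x is nonzero. Given the coefficients of earlier slots, x is nonzero on the next packet sent by that
node with probability 1/2, so every packet received over the link leaving the frontier advances it
with probability 1/2. Hence β^(number of such packets) · ((2-β)/β)^(position) is a martingale.
Markov's inequality and a union bound over x make failure unlikely once all frontier paths have met
m packets, m slightly above k (`codeMeasure_not_decodable_le`).

How many packets a frontier path meets is a question about losses only. Let b be the link with the
smallest parameter, and let each link i serve a fictitious queue fed by the receptions over b. A
path climbing one link at a time meets as many packets as b receives, up to the sum of the maximal
queue lengths (`sum_le_sum_path_add_queueMax`). The other parameters exceed p_b by a relative gap,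
so these queues are stable and their maxima are only logarithmic: a Lyapunov function of length q
and maximum s has drift at most p_b(ζ²-1) (`lyap_drift`). Stop when the receptions over b exceed the
queueing loss by m; the drift bound and concavity of log give a self-bounding inequality for the
expected number of receptions over b until then (`expectedBelow_le`), which is p_b times the
expected stopping time.

The delay is at most this stopping time plus the time for which decoding still fails afterwards.
Averaged over the losses, the first term is at most (k + X/2)/p_b for every code, where X = kL/w;
the second has a tiny mean over codes, and Markov's inequality yields ε
(`codeMeasure_avgCodingDelay_le`). The asymptotic hypotheses ensure that m - k and the queueing loss
are fractions of X, so η = 0 suffices. -/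

/-! ### Functions of finitely many coordinates on a product space -/

section FiniteDependence

variable {ι : Type*} {X : ι → Type*}

/-- A function of finitely many coordinates factors through their restriction map. -/
theorem DependsOn.exists_comp_restrict {Y : Type*} [Nonempty Y] {f : (∀ i, X i) → Y}
    {s : Set ι} (hf : DependsOn f s) (hs : s.Finite) :
    ∃ g : (∀ i : hs.toFinset, X i) → Y, f = fun x => g (hs.toFinset.restrict x) := by
  have h : Function.FactorsThrough f (hs.toFinset.restrict (π := X)) := by
    intro x y hxy
    refine hf fun i hi => ?_
    exact congrFun hxy ⟨i, hs.mem_toFinset.2 hi⟩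
  obtain ⟨g, hg⟩ := (Function.factorsThrough_iff _).1 h
  exact ⟨g, hg⟩

variable [∀ i, MeasurableSpace (X i)] [∀ i, Finite (X i)] [∀ i, MeasurableSingletonClass (X i)]

theorem DependsOn.measurable {Y : Type*} [MeasurableSpace Y] {f : (∀ i, X i) → Y}
    {s : Set ι} (hf : DependsOn f s) (hs : s.Finite) : Measurable f := by
  rcases isEmpty_or_nonempty Y with hY | hY
  · intro t _
    have : f ⁻¹' t = ∅ := by ext x; exact hY.elim (f x)
    rw [this]; exact MeasurableSet.empty
  obtain ⟨g, rfl⟩ := hf.exists_comp_restrict hs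
  exact (measurable_of_finite g).comp (Finset.measurable_restrict _)

theorem DependsOn.integrable {μ : Measure (∀ i, X i)} [IsFiniteMeasure μ] {f : (∀ i, X i) → ℝ}
    {s : Set ι} (hf : DependsOn f s) (hs : s.Finite) : Integrable f μ := by
  have hm := hf.measurable hs
  obtain ⟨g, rfl⟩ := hf.exists_comp_restrict hs
  obtain ⟨C, hC⟩ := (Set.finite_range fun y => ‖g y‖).bddAbove
  exact Integrable.of_bound hm.aestronglyMeasurable C
    (Eventually.of_forall fun x => hC ⟨_, rfl⟩)

theorem DependsOn.integral_mul {μ : ∀ i, Measure (X i)} [∀ i, IsProbabilityMeasure (μ i)]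
    {f g : (∀ i, X i) → ℝ} {s t : Set ι} (hf : DependsOn f s) (hg : DependsOn g t)
    (hs : s.Finite) (ht : t.Finite) (hst : Disjoint s t) :
    ∫ x, f x * g x ∂Measure.infinitePi μ
      = (∫ x, f x ∂Measure.infinitePi μ) * ∫ x, g x ∂Measure.infinitePi μ := by
  have hfm := hf.measurable hs
  have hgm := hg.measurable ht
  obtain ⟨f', rfl⟩ := hf.exists_comp_restrict hs
  obtain ⟨g', rfl⟩ := hg.exists_comp_restrict ht
  have hind : iIndepFun (fun i (x : ∀ i, X i) => x i) (Measure.infinitePi μ) :=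
    iIndepFun_infinitePi (P := μ) (X := fun i x => x) (fun i => measurable_id)
  have h2 := hind.indepFun_finset hs.toFinset ht.toFinset
    (by rw [Set.Finite.disjoint_toFinset]; exact hst) (fun i => measurable_pi_apply i)
  have h3 := h2.comp (measurable_of_finite f') (measurable_of_finite g')
  exact h3.integral_fun_mul_eq_mul_integral hfm.aestronglyMeasurable hgm.aestronglyMeasurable

theorem measurable_prod_of_dependsOn {κ : Type*} {Z : κ → Type*} [∀ i, MeasurableSpace (Z i)]
    [∀ i, Finite (Z i)] [∀ i, MeasurableSingletonClass (Z i)] {Y : Type*} [MeasurableSpace Y]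
    [Nonempty Y]
    {f : (∀ i, X i) → (∀ i, Z i) → Y} {s : Set ι} {t : Set κ} (hs : s.Finite) (ht : t.Finite)
    (hf₁ : ∀ z, DependsOn (fun x => f x z) s) (hf₂ : ∀ x, DependsOn (f x) t) :
    Measurable fun q : (∀ i, X i) × (∀ i, Z i) => f q.1 q.2 := by
  have h : Function.FactorsThrough (fun q : (∀ i, X i) × (∀ i, Z i) => f q.1 q.2)
      (Prod.map (hs.toFinset.restrict (π := X)) (ht.toFinset.restrict (π := Z))) := by
    rintro ⟨x, z⟩ ⟨x', z'⟩ h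
    have h1 : f x z = f x' z := hf₁ z fun i hi =>
      congrFun (congrArg Prod.fst h) ⟨i, hs.mem_toFinset.2 hi⟩
    have h2 : f x' z = f x' z' := hf₂ x' fun i hi =>
      congrFun (congrArg Prod.snd h) ⟨i, ht.mem_toFinset.2 hi⟩
    exact h1.trans h2
  obtain ⟨g, hg⟩ := (Function.factorsThrough_iff _).1 h
  rw [hg]
  exact (measurable_of_finite g).comp
    ((Finset.measurable_restrict _).prodMap (Finset.measurable_restrict _))

end FiniteDependence

/-! ### Flipping a coordinate of a uniform binary family -/

section Flip

variable {ι : Type*} [DecidableEq ι]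

theorem measurePreserving_add_single (i : ι) :
    MeasurePreserving (fun c : ι → ZMod 2 => c + Pi.single i 1)
      (Measure.infinitePi fun _ : ι => (PMF.uniformOfFintype (ZMod 2)).toMeasure)
      (Measure.infinitePi fun _ : ι => (PMF.uniformOfFintype (ZMod 2)).toMeasure) := by
  refine ⟨by fun_prop, ?_⟩
  have h := Measure.infinitePi_map_pi
    (μ := fun _ : ι => (PMF.uniformOfFintype (ZMod 2)).toMeasure)
    (f := fun j (x : ZMod 2) => x + (Pi.single i (1 : ZMod 2) : ι → ZMod 2) j)
    (fun j => measurable_of_finite _)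
  refine Eq.trans h ?_
  congr 1
  funext j
  refine Measure.ext_of_singleton fun a => ?_
  have hpre : (fun x : ZMod 2 => x + (Pi.single i (1 : ZMod 2) : ι → ZMod 2) j) ⁻¹' {a}
      = {a - (Pi.single i (1 : ZMod 2) : ι → ZMod 2) j} := by
    ext x
    simp only [Set.mem_preimage, Set.mem_singleton_iff, eq_sub_iff_add_eq]
  rw [Measure.map_apply (measurable_of_finite _) (measurableSet_singleton a), hpre,
    PMF.toMeasure_apply_singleton _ _ (measurableSet_singleton _),
    PMF.toMeasure_apply_singleton _ _ (measurableSet_singleton _),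
    PMF.uniformOfFintype_apply, PMF.uniformOfFintype_apply]

/-- Replaces conditioning on the past. The flipped coordinate depends on c only through `e c`, which
the flip preserves; on each fibre of `e` it is one fixed coordinate, so the flip is a
measure-preserving involution of the fibre and W may be averaged with its flipped copy. -/
theorem lintegral_le_of_flip {E : Type*} [Countable E] [MeasurableSpace E]
    [MeasurableSingletonClass E] {e : (ι → ZMod 2) → E} (he : Measurable e) (g : E → ι)
    (hflip : ∀ c, e (c + Pi.single (g (e c)) 1) = e c) {V W : (ι → ZMod 2) → ℝ≥0∞}
    (hW : Measurable W)
    (h : ∀ c, W c + W (c + Pi.single (g (e c)) 1) ≤ 2 * V c) :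
    ∫⁻ c, W c ∂(Measure.infinitePi fun _ : ι => (PMF.uniformOfFintype (ZMod 2)).toMeasure)
      ≤ ∫⁻ c, V c ∂(Measure.infinitePi fun _ : ι => (PMF.uniformOfFintype (ZMod 2)).toMeasure) := by
  set ν := Measure.infinitePi fun _ : ι => (PMF.uniformOfFintype (ZMod 2)).toMeasure
  have hS : ∀ a, MeasurableSet (e ⁻¹' {a}) := fun a => he (measurableSet_singleton a)
  have hpart : ∀ U : (ι → ZMod 2) → ℝ≥0∞, ∫⁻ c, U c ∂ν = ∑' a, ∫⁻ c in e ⁻¹' {a}, U c ∂ν := by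
    intro U
    rw [← lintegral_iUnion hS, ← Set.preimage_iUnion, Set.iUnion_of_singleton, Set.preimage_univ,
      Measure.restrict_univ]
    intro a b hab
    exact Disjoint.preimage _ (by simpa using hab)
  rw [hpart W, hpart V]
  refine ENNReal.tsum_le_tsum fun a => ?_
  set σ : (ι → ZMod 2) → (ι → ZMod 2) := fun c => c + Pi.single (g a) 1
  have hσ : MeasurePreserving σ ν ν := measurePreserving_add_single (g a)
  have hinv : ∀ c, σ (σ c) = c := by
    intro c
    simp only [σ, add_assoc, ← Pi.single_add]
    have : (1 : ZMod 2) + 1 = 0 := rfl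
    simp [this]
  have hpre : σ ⁻¹' (e ⁻¹' {a}) = e ⁻¹' {a} := by
    ext c
    simp only [Set.mem_preimage, Set.mem_singleton_iff]
    constructor
    · intro hc
      have := hflip (σ c)
      rw [hc] at this
      rw [← this]; exact congrArg e (hinv c).symm
    · intro hc
      have := hflip c
      rw [hc] at this
      exact this
  have h1 : ∫⁻ c in e ⁻¹' {a}, W (σ c) ∂ν = ∫⁻ c in e ⁻¹' {a}, W c ∂ν := by
    conv_lhs => rw [← hpre]
    exact hσ.setLIntegral_comp_preimage (hS a) hW
  have h2 : 2 * ∫⁻ c in e ⁻¹' {a}, W c ∂ν ≤ 2 * ∫⁻ c in e ⁻¹' {a}, V c ∂ν := by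
    calc 2 * ∫⁻ c in e ⁻¹' {a}, W c ∂ν
        = ∫⁻ c in e ⁻¹' {a}, (W c + W (σ c)) ∂ν := by
          rw [lintegral_add_left hW, h1, two_mul]
      _ ≤ ∫⁻ c in e ⁻¹' {a}, 2 * V c ∂ν := by
          refine setLIntegral_mono' (hS a) fun c hc => ?_
          have := h c
          rw [show e c = a from hc] at this
          exact this
      _ = 2 * ∫⁻ c in e ⁻¹' {a}, V c ∂ν := lintegral_const_mul' _ _ (by simp)
  exact (ENNReal.mul_le_mul_iff_right (by simp) (by simp)).1 h2

end Flip

/-! ### Queues driven by the arrivals at a reference link -/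

section Queue

/-- Length at time `n` of a queue with arrivals `x t` and services `y t` in slot `t`. -/
def queueLen (x y : ℕ → ℕ) : ℕ → ℕ
  | 0 => 0
  | n + 1 => queueLen x y n + x n - y n

/-- Largest length up to time `n` of a queue with arrivals `x` and services `y`. -/
def queueMax (x y : ℕ → ℕ) : ℕ → ℕ
  | 0 => 0
  | n + 1 => max (queueMax x y n) (queueLen x y (n + 1))

theorem queueLen_le_queueMax (x y : ℕ → ℕ) (n : ℕ) : queueLen x y n ≤ queueMax x y n := by
  cases n with
  | zero => exact le_rfl
  | succ n => exact le_max_right _ _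

theorem queueMax_le_succ (x y : ℕ → ℕ) (n : ℕ) : queueMax x y n ≤ queueMax x y (n + 1) :=
  le_max_left _ _

theorem queueLen_self (x : ℕ → ℕ) (n : ℕ) : queueLen x x n = 0 := by
  induction n with
  | zero => rfl
  | succ n ih => simp [queueLen, ih]

theorem queueMax_self (x : ℕ → ℕ) (n : ℕ) : queueMax x x n = 0 := by
  induction n with
  | zero => rfl
  | succ n ih => simp [queueMax, ih, queueLen_self]

theorem queueLen_congr {x y x' y' : ℕ → ℕ} {n : ℕ} (hx : ∀ t < n, x t = x' t)
    (hy : ∀ t < n, y t = y' t) : queueLen x y n = queueLen x' y' n := by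
  induction n with
  | zero => rfl
  | succ n ih =>
    simp only [queueLen]
    rw [ih (fun t ht => hx t (ht.trans n.lt_succ_self)) (fun t ht => hy t (ht.trans n.lt_succ_self)),
      hx n n.lt_succ_self, hy n n.lt_succ_self]

theorem queueMax_congr {x y x' y' : ℕ → ℕ} {n : ℕ} (hx : ∀ t < n, x t = x' t)
    (hy : ∀ t < n, y t = y' t) : queueMax x y n = queueMax x' y' n := by
  induction n with
  | zero => rfl
  | succ n ih =>
    simp only [queueMax]
    rw [ih (fun t ht => hx t (ht.trans n.lt_succ_self)) (fun t ht => hy t (ht.trans n.lt_succ_self)),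
      queueLen_congr hx hy]

/-- A path that climbs through the layers meets at least as many arrivals as the reference layer
`b` does, up to the maximal queue lengths of the layers it visits. -/
theorem sum_le_sum_path_add_queueMax (a : ℕ → ℕ → ℕ) (b : ℕ) (J : ℕ → ℕ)
    (hJ : ∀ n, J (n + 1) = J n ∨ J (n + 1) = J n + 1) (n : ℕ) :
    ∑ t ∈ Finset.range n, a b t ≤ ∑ t ∈ Finset.range n, a (J t) t
      + ∑ i ∈ Finset.range (J n), queueMax (a b) (a i) n + queueLen (a b) (a (J n)) n := by
  induction n with
  | zero => simp
  | succ n ih =>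
    rw [Finset.sum_range_succ, Finset.sum_range_succ _ n]
    have h1 : ∑ i ∈ Finset.range (J n), queueMax (a b) (a i) n
        ≤ ∑ i ∈ Finset.range (J n), queueMax (a b) (a i) (n + 1) :=
      Finset.sum_le_sum fun i _ => queueMax_le_succ _ _ _
    have h2 : queueLen (a b) (a (J n)) n + a b n
        ≤ a (J n) n + queueLen (a b) (a (J n)) (n + 1) := by
      simp only [queueLen]; omega
    rcases hJ n with h | h
    · rw [h]; omega
    -- When the path leaves a layer, the queue left there is charged to that layer's maximum.
    · rw [h, Finset.sum_range_succ]
      have h3 := queueLen_le_queueMax (a b) (a (J n)) (n + 1)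
      omega

end Queue

/-! ### Drift of a queue together with its running maximum -/

section Lyapunov

/-- Lyapunov function of a queue of length `q` and maximal length `s`. -/
noncomputable def lyap (ζ : ℝ) (q s : ℕ) : ℝ := ζ ^ s + ζ ^ (2 * q) / ζ ^ s

theorem pow_le_lyap {ζ : ℝ} (hζ : 1 ≤ ζ) (q s : ℕ) : ζ ^ s ≤ lyap ζ q s := by
  unfold lyap
  have : 0 ≤ ζ ^ (2 * q) / ζ ^ s := by positivity
  linarith

/-- The queue moves up at rate a = p(1-p') and down at rate d = (1-p)p', and the hypothesis gives
ζ²a ≤ d. This makes the drift nonpositive except at the empty queue, where no downward move can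
compensate. -/
theorem lyap_drift {ζ p p' : ℝ} (hζ : 1 ≤ ζ) (hp : 0 ≤ p) (hp' : p' ≤ 1) (h : ζ ^ 2 * p ≤ p')
    {q s : ℕ} (hqs : q ≤ s) :
    p * (1 - p') * (lyap ζ (q + 1) (max s (q + 1)) - lyap ζ q s)
      + (1 - p) * p' * (lyap ζ (q - 1) s - lyap ζ q s) ≤ p * (ζ ^ 2 - 1) := by
  have hζ0 : 0 < ζ := by linarith
  have hζ2 : 1 ≤ ζ ^ 2 := one_le_pow₀ hζ
  have hpp : p ≤ p' := le_trans (by nlinarith) h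
  have hp0 : 0 ≤ p' := hp.trans hpp
  have had : ζ ^ 2 * (p * (1 - p')) ≤ (1 - p) * p' := by
    have : ζ ^ 2 * p * (1 - p') ≤ p' * (1 - p') :=
      mul_le_mul_of_nonneg_right h (by linarith)
    nlinarith
  have ha : 0 ≤ p * (1 - p') := mul_nonneg hp (by linarith)
  have hap : p * (1 - p') ≤ p := by nlinarith
  set a := p * (1 - p') with hadef
  set d := (1 - p) * p' with hddef
  have hR : 0 ≤ p * (ζ ^ 2 - 1) := mul_nonneg hp (by linarith)
  have hs : 0 < ζ ^ s := by positivity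
  rcases hqs.lt_or_eq with hlt | rfl
  · rw [max_eq_left (by omega)]
    rcases q with _ | q
    · simp only [lyap, zero_add, Nat.zero_sub, mul_zero, pow_zero, mul_one, sub_self, add_zero]
      have h1 : ζ ^ s + ζ ^ 2 / ζ ^ s - (ζ ^ s + 1 / ζ ^ s) = (ζ ^ 2 - 1) / ζ ^ s := by ring
      rw [h1]
      have h2 : (ζ ^ 2 - 1) / ζ ^ s ≤ ζ ^ 2 - 1 :=
        div_le_self (by linarith) (one_le_pow₀ hζ)
      have h3 : 0 ≤ (ζ ^ 2 - 1) / ζ ^ s := div_nonneg (by linarith) hs.le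
      calc a * ((ζ ^ 2 - 1) / ζ ^ s) ≤ p * ((ζ ^ 2 - 1) / ζ ^ s) :=
            mul_le_mul_of_nonneg_right hap h3
        _ ≤ p * (ζ ^ 2 - 1) := mul_le_mul_of_nonneg_left h2 hp
    -- Below the maximum only ζ^(2q-s) changes, and its drift has the sign of ζ²a - d.
    · refine le_trans ?_ hR
      simp only [lyap, Nat.add_sub_cancel]
      have e : a * (ζ ^ s + ζ ^ (2 * (q + 1 + 1)) / ζ ^ s - (ζ ^ s + ζ ^ (2 * (q + 1)) / ζ ^ s))
          + d * (ζ ^ s + ζ ^ (2 * q) / ζ ^ s - (ζ ^ s + ζ ^ (2 * (q + 1)) / ζ ^ s))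
          = (ζ ^ (2 * q) / ζ ^ s) * (ζ ^ 2 - 1) * (ζ ^ 2 * a - d) := by ring
      rw [e]
      exact mul_nonpos_of_nonneg_of_nonpos
        (mul_nonneg (by positivity) (by linarith)) (by linarith)
  · rw [max_eq_right (by omega)]
    rcases q with _ | q
    · simp only [lyap, zero_add, Nat.zero_sub, mul_zero, pow_zero, mul_one, sub_self, add_zero,
        pow_one, div_one]
      have h1 : ζ + ζ ^ 2 / ζ - (1 + 1) = 2 * (ζ - 1) := by field_simp; ring
      rw [h1]
      calc a * (2 * (ζ - 1)) ≤ p * (2 * (ζ - 1)) :=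
            mul_le_mul_of_nonneg_right hap (by linarith)
        _ ≤ p * (ζ ^ 2 - 1) := mul_le_mul_of_nonneg_left (by nlinarith) hp
    -- At the maximum an upward move raises both summands equally, so 2ζ²a ≤ (ζ+1)d is needed; it
    -- follows from ζ²a ≤ d and ζ ≥ 1.
    · refine le_trans ?_ hR
      simp only [lyap, Nat.add_sub_cancel]
      have e : a * (ζ ^ (q + 1 + 1) + ζ ^ (2 * (q + 1 + 1)) / ζ ^ (q + 1 + 1)
            - (ζ ^ (q + 1) + ζ ^ (2 * (q + 1)) / ζ ^ (q + 1)))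
          + d * (ζ ^ (q + 1) + ζ ^ (2 * q) / ζ ^ (q + 1)
            - (ζ ^ (q + 1) + ζ ^ (2 * (q + 1)) / ζ ^ (q + 1)))
          = (ζ ^ q / ζ) * (ζ - 1) * (2 * (ζ ^ 2 * a) - (ζ + 1) * d) := by
        field_simp
        ring
      rw [e]
      have hd : 0 ≤ d := le_trans (mul_nonneg (by positivity) ha) had
      exact mul_nonpos_of_nonneg_of_nonpos
        (mul_nonneg (by positivity) (by linarith)) (by nlinarith)

end Lyapunov

/-! ### Traffic: queueing loss and the stopping time -/

namespace LineNetwork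

variable {net : LineNetwork}

/-- Number of packets (`0` or `1`) received over link `i` in slot `t`. -/
def arr (τ : net.Traffic) (i t : ℕ) : ℕ :=
  if h : i < net.L then (τ (⟨i, h⟩, t)).toNat else 0

/-- Sum over all links of the maximal queue length that link `i` would show up to time `n` if it
were fed with the packets received over link `b`. -/
def queueLoss (τ : net.Traffic) (b n : ℕ) : ℕ :=
  ∑ i ∈ Finset.range net.L, queueMax (arr τ b) (arr τ i) n

/-- Up to time `n`, the number of packets received over link `b` has not exceeded the queueing loss
by `m`. -/
def Below (τ : net.Traffic) (b m n : ℕ) : Prop :=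
  ∀ n' ≤ n, ∑ t ∈ Finset.range n', arr τ b t < m + queueLoss τ b n'

theorem Below.mono {τ : net.Traffic} {b m m' n n' : ℕ} (h : Below τ b m n) (hm : m ≤ m')
    (hn : n' ≤ n) : Below τ b m' n' :=
  fun j hj => (h j (hj.trans hn)).trans_le (by omega)

open Classical in
/-- The time at which `Below` first fails, truncated at `n`. -/
noncomputable def stopIdx (τ : net.Traffic) (b m : ℕ) : ℕ → ℕ
  | 0 => 0
  | n + 1 => if Below τ b m n then n + 1 else stopIdx τ b m n

/-- Indicator of `Below`. -/
noncomputable def belowInd (b m n : ℕ) : net.Traffic → ℝ :=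
  Set.indicator {τ | Below τ b m n} 1

theorem belowInd_of (τ : net.Traffic) {b m n : ℕ} (h : Below τ b m n) :
    belowInd b m n τ = 1 := Set.indicator_of_mem (s := {τ : net.Traffic | Below τ b m n}) h 1

theorem belowInd_of_not (τ : net.Traffic) {b m n : ℕ} (h : ¬ Below τ b m n) :
    belowInd b m n τ = 0 := Set.indicator_of_notMem (s := {τ : net.Traffic | Below τ b m n}) h 1

theorem belowInd_nonneg (τ : net.Traffic) (b m n : ℕ) : 0 ≤ belowInd b m n τ :=
  Set.indicator_nonneg (fun _ _ => zero_le_one) _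

theorem stopIdx_of_below {τ : net.Traffic} {b m n : ℕ} (h : Below τ b m n) :
    stopIdx τ b m n = n := by
  cases n with
  | zero => rfl
  | succ n => simp [stopIdx, h.mono le_rfl n.le_succ]

/-- Optional stopping in pathwise form: `Below` at time t is decided by the slots before t and, once
lost, never returns, so the sum telescopes up to the stopping time. -/
theorem sum_belowInd_mul_sub (τ : net.Traffic) (b m n : ℕ) (X : ℕ → ℝ) :
    ∑ t ∈ Finset.range n, belowInd b m t τ * (X (t + 1) - X t) = X (stopIdx τ b m n) - X 0 := by
  induction n with
  | zero => simp [stopIdx]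
  | succ n ih =>
    rw [Finset.sum_range_succ, ih]
    by_cases h : Below τ b m n
    · rw [belowInd_of τ h, stopIdx_of_below h, stopIdx, if_pos h]; ring
    · rw [belowInd_of_not τ h, stopIdx, if_neg h]; ring

theorem arr_le_one (τ : net.Traffic) (i t : ℕ) : arr τ i t ≤ 1 := by
  unfold arr
  split_ifs
  · exact Bool.toNat_le _
  · exact Nat.zero_le _

theorem queueLoss_le_succ (τ : net.Traffic) (b n : ℕ) :
    queueLoss τ b n ≤ queueLoss τ b (n + 1) :=
  Finset.sum_le_sum fun _ _ => queueMax_le_succ _ _ _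

/-- There is no overshoot: a slot brings at most one packet and the loss never decreases. -/
theorem sum_arr_stopIdx_le (τ : net.Traffic) (b m n : ℕ) :
    ∑ t ∈ Finset.range (stopIdx τ b m n), arr τ b t ≤ m + queueLoss τ b (stopIdx τ b m n) := by
  induction n with
  | zero => simp [stopIdx]
  | succ n ih =>
    by_cases h : Below τ b m n
    · rw [stopIdx, if_pos h, Finset.sum_range_succ]
      have h1 := h n le_rfl
      have h2 := arr_le_one τ b n
      have h3 := queueLoss_le_succ τ b n
      omega
    · rwa [stopIdx, if_neg h]

/-! ### Dependence on finitely many slots -/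

/-- The transmissions in the slots before `n`. -/
def pastSlots (net : LineNetwork) (n : ℕ) : Set (Fin net.L × ℕ) := {x | x.2 < n}

theorem finite_pastSlots (n : ℕ) : (pastSlots net n).Finite :=
  ((Set.finite_univ (α := Fin net.L)).prod (Set.finite_Iio n)).subset
    fun _ hx => ⟨trivial, hx⟩

theorem arr_congr {τ τ' : net.Traffic} {n : ℕ} (h : ∀ x ∈ pastSlots net n, τ x = τ' x)
    (i : ℕ) : ∀ t < n, arr τ i t = arr τ' i t := by
  intro t ht
  unfold arr
  split_ifs with hi
  · rw [h (⟨i, hi⟩, t) ht]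
  · rfl

theorem pastSlots_mono {n n' : ℕ} (h : n' ≤ n) : pastSlots net n' ⊆ pastSlots net n :=
  fun _ hx => lt_of_lt_of_le hx h

theorem below_congr {τ τ' : net.Traffic} {b m n : ℕ} (h : ∀ x ∈ pastSlots net n, τ x = τ' x) :
    Below τ b m n ↔ Below τ' b m n := by
  unfold Below
  refine forall₂_congr fun n' hn' => ?_
  have h' : ∀ x ∈ pastSlots net n', τ x = τ' x := fun x hx => h x (pastSlots_mono hn' hx)
  have e1 : ∑ t ∈ Finset.range n', arr τ b t = ∑ t ∈ Finset.range n', arr τ' b t :=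
    Finset.sum_congr rfl fun t ht => arr_congr h' b t (Finset.mem_range.1 ht)
  have e2 : queueLoss τ b n' = queueLoss τ' b n' :=
    Finset.sum_congr rfl fun i _ => queueMax_congr (arr_congr h' b) (arr_congr h' i)
  rw [e1, e2]

theorem dependsOn_belowInd (b m n : ℕ) :
    DependsOn (belowInd (net := net) b m n) (pastSlots net n) := by
  intro τ τ' h
  by_cases hb : Below τ b m n
  · rw [belowInd_of τ hb, belowInd_of τ' ((below_congr h).1 hb)]
  · rw [belowInd_of_not τ hb, belowInd_of_not τ' (fun h' => hb ((below_congr h).2 h'))]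

theorem measurableSet_below (b m n : ℕ) : MeasurableSet {τ : net.Traffic | Below τ b m n} := by
  have h : DependsOn (fun τ : net.Traffic => Below τ b m n) (pastSlots net n) :=
    fun τ τ' h => propext (below_congr h)
  exact measurableSet_setOfPred.2 (h.measurable (finite_pastSlots n))

theorem integral_belowInd (b m n : ℕ) :
    ∫ τ, belowInd b m n τ ∂net.trafficMeasure
      = net.trafficMeasure.real {τ | Below τ b m n} :=
  integral_indicator_one (measurableSet_below b m n)

theorem dependsOn_arr (i t : ℕ) :
    DependsOn (fun τ : net.Traffic => (arr τ i t : ℝ)) {x : Fin net.L × ℕ | x.1 = i ∧ x.2 = t} := by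
  intro τ τ' h
  simp only [arr]
  split_ifs with hi
  · rw [h (⟨i, hi⟩, t) ⟨rfl, rfl⟩]
  · rfl

theorem finite_singleSlot (i t : ℕ) : {x : Fin net.L × ℕ | (x.1 : ℕ) = i ∧ x.2 = t}.Finite :=
  (finite_pastSlots (t + 1)).subset fun x hx => by
    simp only [pastSlots, Set.mem_ofPred_eq] at hx ⊢; omega

theorem integral_arr (i : Fin net.L) (t : ℕ) :
    ∫ τ, (arr τ i t : ℝ) ∂net.trafficMeasure = net.p i := by
  have h := measurePreserving_eval_infinitePi
    (fun x : Fin net.L × ℕ => bernoulliMeasure true false (net.prob x.1)) (i, t)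
  calc ∫ τ, (arr τ i t : ℝ) ∂net.trafficMeasure
      = ∫ τ, ((Function.eval (i, t) τ : Bool).toNat : ℝ) ∂net.trafficMeasure := by
        simp [arr, Function.eval]
    _ = ∫ x : Bool, (x.toNat : ℝ) ∂(bernoulliMeasure true false (net.prob i)) := by
        rw [← h.map_eq, integral_map h.measurable.aemeasurable
          (measurable_of_finite _).aestronglyMeasurable]
        rfl
    _ = net.p i := by simp [integral_bernoulliMeasure, prob]

/-- A function of the past is independent of the transmissions over a link in the present slot. -/
theorem integral_past_mul {F G : net.Traffic → ℝ} {s : Set (Fin net.L × ℕ)} {n : ℕ}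
    (hF : DependsOn F (pastSlots net n)) (hG : DependsOn G s) (hs : s ⊆ {x | x.2 = n}) :
    ∫ τ, F τ * G τ ∂net.trafficMeasure
      = (∫ τ, F τ ∂net.trafficMeasure) * ∫ τ, G τ ∂net.trafficMeasure := by
  refine hF.integral_mul hG (finite_pastSlots n)
    ((finite_pastSlots (n + 1)).subset fun x hx => ?_) ?_
  · have := hs hx
    simp only [pastSlots, Set.mem_ofPred_eq] at this ⊢; omega
  · refine Set.disjoint_left.2 fun x hx hx' => ?_
    have := hs hx'
    simp only [pastSlots, Set.mem_ofPred_eq] at this hx; omega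

theorem integral_arr_mul_one_sub_arr {i j : Fin net.L} (hij : i ≠ j) (t : ℕ) :
    ∫ τ, (arr τ i t : ℝ) * (1 - arr τ j t) ∂net.trafficMeasure = net.p i * (1 - net.p j) := by
  have hj := dependsOn_arr (net := net) j t
  have h : DependsOn (fun τ : net.Traffic => (1 - arr τ j t : ℝ))
      {x : Fin net.L × ℕ | (x.1 : ℕ) = j ∧ x.2 = t} :=
    fun τ τ' hτ => congrArg (fun z : ℝ => 1 - z) (hj hτ)
  have hind := (dependsOn_arr (net := net) i t).integral_mul
    (μ := fun x : Fin net.L × ℕ => bernoulliMeasure true false (net.prob x.1))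
    h (finite_singleSlot i t) (finite_singleSlot j t)
    (Set.disjoint_left.2 fun x hx hx' => hij (Fin.ext (hx.1.symm.trans hx'.1)))
  refine hind.trans ?_
  have e1 := integral_arr i t
  have e2 : ∫ τ, (1 - arr τ j t : ℝ) ∂net.trafficMeasure = 1 - net.p j := by
    rw [integral_sub (integrable_const _) (hj.integrable (finite_singleSlot j t)),
      integral_arr j t]
    simp
  exact congrArg₂ (· * ·) e1 e2

/-! ### Drift of the Lyapunov function -/

/-- The Lyapunov function of the queue at link `i` that is fed by link `b`. -/
noncomputable def lyapAt (ζ : ℝ) (b i n : ℕ) (τ : net.Traffic) : ℝ :=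
  lyap ζ (queueLen (arr τ b) (arr τ i) n) (queueMax (arr τ b) (arr τ i) n)

/-- A simultaneous arrival and service cancel. The form separates factors determined by the past
from factors determined by slot n, which are independent. -/
theorem lyapAt_succ_sub (ζ : ℝ) (b i n : ℕ) (τ : net.Traffic) :
    lyapAt ζ b i (n + 1) τ - lyapAt ζ b i n τ
      = (lyap ζ (queueLen (arr τ b) (arr τ i) n + 1)
            (max (queueMax (arr τ b) (arr τ i) n) (queueLen (arr τ b) (arr τ i) n + 1))
          - lyapAt ζ b i n τ) * (arr τ b n * (1 - arr τ i n))
        + (lyap ζ (queueLen (arr τ b) (arr τ i) n - 1) (queueMax (arr τ b) (arr τ i) n)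
          - lyapAt ζ b i n τ) * (arr τ i n * (1 - arr τ b n)) := by
  have hx := arr_le_one τ b n
  have hy := arr_le_one τ i n
  have hqs := queueLen_le_queueMax (arr τ b) (arr τ i) n
  unfold lyapAt
  simp only [queueLen, queueMax]
  interval_cases hxv : arr τ b n <;> interval_cases hyv : arr τ i n
  · simp [max_eq_left hqs]
  · have : max (queueMax (arr τ b) (arr τ i) n) (queueLen (arr τ b) (arr τ i) n - 1)
        = queueMax (arr τ b) (arr τ i) n := max_eq_left (by omega)
    simp [this]
  · simp
  · simp [max_eq_left hqs]

theorem dependsOn_of_queue {Y : Type*} (b i n : ℕ) (f : ℕ → ℕ → Y) :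
    DependsOn (fun τ : net.Traffic =>
      f (queueLen (arr τ b) (arr τ i) n) (queueMax (arr τ b) (arr τ i) n)) (pastSlots net n) := by
  intro τ τ' h
  simp only
  rw [queueLen_congr (arr_congr h b) (arr_congr h i),
    queueMax_congr (arr_congr h b) (arr_congr h i)]

theorem dependsOn_mul {F G : net.Traffic → ℝ} {s : Set (Fin net.L × ℕ)} (hF : DependsOn F s)
    (hG : DependsOn G s) : DependsOn (fun τ => F τ * G τ) s :=
  fun _ _ h => congrArg₂ (· * ·) (hF h) (hG h)

theorem integral_below_drift_le {ζ : ℝ} (hζ : 1 ≤ ζ) {b i : Fin net.L} (hbi : b ≠ i)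
    (h : ζ ^ 2 * net.p b ≤ net.p i) (m n : ℕ) :
    ∫ τ, belowInd b m n τ * (lyapAt ζ b i (n + 1) τ - lyapAt ζ b i n τ) ∂net.trafficMeasure
      ≤ net.p b * (ζ ^ 2 - 1) * net.trafficMeasure.real {τ | Below τ b m n} := by
  set U : net.Traffic → ℝ := fun τ => belowInd b m n τ *
    (lyap ζ (queueLen (arr τ b) (arr τ i) n + 1)
      (max (queueMax (arr τ b) (arr τ i) n) (queueLen (arr τ b) (arr τ i) n + 1))
      - lyapAt ζ b i n τ) with hU
  set D : net.Traffic → ℝ := fun τ => belowInd b m n τ *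
    (lyap ζ (queueLen (arr τ b) (arr τ i) n - 1) (queueMax (arr τ b) (arr τ i) n)
      - lyapAt ζ b i n τ) with hD
  have hUd : DependsOn U (pastSlots net n) := dependsOn_mul (dependsOn_belowInd b m n)
    (dependsOn_of_queue b i n fun q s => lyap ζ (q + 1) (max s (q + 1)) - lyap ζ q s)
  have hDd : DependsOn D (pastSlots net n) := dependsOn_mul (dependsOn_belowInd b m n)
    (dependsOn_of_queue b i n fun q s => lyap ζ (q - 1) s - lyap ζ q s)
  have hGd : ∀ i j : Fin net.L, DependsOn
      (fun τ : net.Traffic => (arr τ i n : ℝ) * (1 - arr τ j n)) {x : Fin net.L × ℕ | x.2 = n} := by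
    intro i j τ τ' hτ
    have e1 : (arr τ i n : ℝ) = arr τ' i n := dependsOn_arr i n fun x hx => hτ x hx.2
    have e2 : (arr τ j n : ℝ) = arr τ' j n := dependsOn_arr j n fun x hx => hτ x hx.2
    simp only [e1, e2]
  have hfin : {x : Fin net.L × ℕ | x.2 = n}.Finite :=
    (finite_pastSlots (n + 1)).subset fun x hx => by
      simp only [pastSlots, Set.mem_ofPred_eq] at hx ⊢; omega
  have hUi := hUd.integrable (μ := net.trafficMeasure) (finite_pastSlots n)
  have hDi := hDd.integrable (μ := net.trafficMeasure) (finite_pastSlots n)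
  have hint : ∀ (F : net.Traffic → ℝ), DependsOn F (pastSlots net n) → ∀ i j : Fin net.L,
      Integrable (fun τ => F τ * ((arr τ i n : ℝ) * (1 - arr τ j n))) net.trafficMeasure := by
    intro F hF i j
    refine DependsOn.integrable (s := pastSlots net n ∪ {x | x.2 = n}) ?_
      ((finite_pastSlots n).union hfin)
    exact dependsOn_mul (hF.mono Set.subset_union_left) ((hGd i j).mono Set.subset_union_right)
  calc ∫ τ, belowInd b m n τ * (lyapAt ζ b i (n + 1) τ - lyapAt ζ b i n τ) ∂net.trafficMeasure
      = ∫ τ, (U τ * (arr τ b n * (1 - arr τ i n)) + D τ * (arr τ i n * (1 - arr τ b n)))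
          ∂net.trafficMeasure := by
        refine integral_congr_ae (Eventually.of_forall fun τ => ?_)
        simp only [lyapAt_succ_sub, hU, hD]
        ring
    _ = (∫ τ, U τ ∂net.trafficMeasure) * (net.p b * (1 - net.p i))
          + (∫ τ, D τ ∂net.trafficMeasure) * (net.p i * (1 - net.p b)) := by
        rw [integral_add (hint U hUd b i) (hint D hDd i b),
          integral_past_mul hUd (hGd b i) subset_rfl, integral_past_mul hDd (hGd i b) subset_rfl,
          integral_arr_mul_one_sub_arr hbi, integral_arr_mul_one_sub_arr hbi.symm]
    _ = ∫ τ, (U τ * (net.p b * (1 - net.p i)) + D τ * (net.p i * (1 - net.p b)))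
          ∂net.trafficMeasure := by
        rw [integral_add (hUi.mul_const _) (hDi.mul_const _), integral_mul_const,
          integral_mul_const]
    _ ≤ ∫ τ, belowInd b m n τ * (net.p b * (ζ ^ 2 - 1)) ∂net.trafficMeasure := by
        refine integral_mono ((hUi.mul_const _).add (hDi.mul_const _))
          (((dependsOn_belowInd b m n).integrable (finite_pastSlots n)).mul_const _) fun τ => ?_
        have hd := lyap_drift hζ (net.p_pos b).le (net.p_le_one i) h
          (queueLen_le_queueMax (arr τ b) (arr τ i) n)
        have := mul_le_mul_of_nonneg_left hd (belowInd_nonneg τ b m n)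
        simp only [hU, hD, lyapAt]
        linarith
    _ = net.p b * (ζ ^ 2 - 1) * net.trafficMeasure.real {τ | Below τ b m n} := by
        rw [integral_mul_const, integral_belowInd, mul_comm]

end LineNetwork

/-! ### Expected receptions over the slowest link up to the stopping time -/

namespace LineNetwork

variable {net : LineNetwork}

/-- Expected number of packets received over link `b` before `Below` fails or time `n` is
reached. -/
noncomputable def expectedBelow (net : LineNetwork) (b : Fin net.L) (m n : ℕ) : ℝ :=
  net.p b * ∑ t ∈ Finset.range n, net.trafficMeasure.real {τ : net.Traffic | Below τ b m t}

theorem expectedBelow_nonneg (b : Fin net.L) (m n : ℕ) : 0 ≤ expectedBelow net b m n :=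
  mul_nonneg (net.p_pos b).le (Finset.sum_nonneg fun _ _ => measureReal_nonneg)

theorem dependsOn_belowInd_mul_arr (b : Fin net.L) (m t : ℕ) :
    DependsOn (fun τ : net.Traffic => belowInd b m t τ * arr τ b t) (pastSlots net (t + 1)) :=
  dependsOn_mul ((dependsOn_belowInd b m t).mono (pastSlots_mono t.le_succ))
    ((dependsOn_arr b t).mono fun x hx => by
      simp only [pastSlots, Set.mem_ofPred_eq] at hx ⊢; omega)

/-- Wald's identity: the decision to continue at time t is independent of slot t. -/
theorem integral_sum_belowInd_mul_arr (b : Fin net.L) (m n : ℕ) :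
    ∫ τ, ∑ t ∈ Finset.range n, belowInd b m t τ * (arr τ b t : ℝ) ∂net.trafficMeasure
      = expectedBelow net b m n := by
  rw [integral_finsetSum _ fun t _ =>
    (dependsOn_belowInd_mul_arr b m t).integrable (finite_pastSlots (t + 1)), expectedBelow,
    Finset.mul_sum]
  refine Finset.sum_congr rfl fun t _ => ?_
  rw [integral_past_mul (dependsOn_belowInd b m t) (dependsOn_arr b t) fun x hx => hx.2,
    integral_belowInd, integral_arr, mul_comm]

theorem integrable_belowInd_mul_lyapAt (ζ : ℝ) (b i : Fin net.L) (m t : ℕ) :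
    Integrable (fun τ : net.Traffic =>
      belowInd b m t τ * (lyapAt ζ b i (t + 1) τ - lyapAt ζ b i t τ)) net.trafficMeasure := by
  refine DependsOn.integrable (s := pastSlots net (t + 1)) (dependsOn_mul
    ((dependsOn_belowInd b m t).mono (pastSlots_mono t.le_succ)) fun τ τ' h => ?_)
    (finite_pastSlots _)
  have e1 := dependsOn_of_queue b i (t + 1) (fun q s => lyap ζ q s) h
  have e2 := dependsOn_of_queue b i t (fun q s => lyap ζ q s)
    fun x hx => h x (pastSlots_mono t.le_succ hx)
  exact congrArg₂ (· - ·) e1 e2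

/-- Tangent line of log at u. It bounds the maximum linearly in the Lyapunov function, so
expectations can be taken directly. -/
theorem nat_mul_log_le {ζ u : ℝ} (hζ : 1 ≤ ζ) (hu : 0 < u) (q s : ℕ) :
    s * Real.log ζ ≤ Real.log u + lyap ζ q s / u - 1 := by
  have h0 : 0 < ζ ^ s := by positivity
  have h1 := Real.log_le_sub_one_of_pos (div_pos h0 hu)
  rw [Real.log_div h0.ne' hu.ne', Real.log_pow] at h1
  have h2 : ζ ^ s / u ≤ lyap ζ q s / u := by gcongr; exact pow_le_lyap hζ q s
  linarith

theorem expectedBelow_le {ζ : ℝ} (hζ : 1 < ζ) (b : Fin net.L)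
    (h : ∀ i, i ≠ b → ζ ^ 2 * net.p b ≤ net.p i) {m : ℕ} (hm : 0 < m) (n : ℕ) :
    expectedBelow net b m n ≤ m + net.L / Real.log ζ *
      (Real.log (2 + (ζ ^ 2 - 1) * m) + expectedBelow net b m n / m) := by
  set y := expectedBelow net b m n with hy
  -- The stopped Lyapunov function has mean at most 2 + (ζ²-1)y. The tangent point u replaces y by
  -- its expected main term m, so that mean is at most u(1 + y/m).
  set u : ℝ := 2 + (ζ ^ 2 - 1) * m with hu
  have hm' : (0 : ℝ) < m := by exact_mod_cast hm
  have hy0 : 0 ≤ y := expectedBelow_nonneg b m n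
  have hζ2 : 0 < ζ ^ 2 - 1 := by nlinarith
  have hu2 : 2 ≤ u := by nlinarith
  have hu0 : 0 < u := by linarith
  have hlog : 0 < Real.log ζ := Real.log_pos hζ
  have hlogu : 0 ≤ Real.log u := Real.log_nonneg (by linarith)
  set G : Fin net.L → net.Traffic → ℝ := fun i τ => 2 + ∑ t ∈ Finset.range n,
    belowInd b m t τ * (lyapAt ζ b i (t + 1) τ - lyapAt ζ b i t τ) with hG
  have hGstop : ∀ i τ, G i τ = lyapAt ζ b i (stopIdx τ b m n) τ := by
    intro i τ
    simp only [hG, sum_belowInd_mul_sub τ b m n fun t => lyapAt ζ b i t τ]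
    have : lyapAt ζ b i 0 τ = 2 := by simp [lyapAt, lyap, queueLen, queueMax]; norm_num
    rw [this]; ring
  have hsumi : ∀ i : Fin net.L, Integrable (fun τ => ∑ t ∈ Finset.range n,
      belowInd b m t τ * (lyapAt ζ b i (t + 1) τ - lyapAt ζ b i t τ)) net.trafficMeasure :=
    fun i => integrable_finsetSum _ fun t _ => integrable_belowInd_mul_lyapAt ζ b i m t
  have hGi : ∀ i, Integrable (G i) net.trafficMeasure :=
    fun i => (integrable_const _).add (hsumi i)
  have hGint : ∀ i, i ≠ b → ∫ τ, G i τ ∂net.trafficMeasure ≤ 2 + (ζ ^ 2 - 1) * y := by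
    intro i hi
    simp only [hG]
    rw [integral_add (integrable_const _) (hsumi i), integral_finsetSum _ fun t _ =>
      integrable_belowInd_mul_lyapAt ζ b i m t]
    have : (ζ ^ 2 - 1) * y = ∑ t ∈ Finset.range n,
        net.p b * (ζ ^ 2 - 1) * net.trafficMeasure.real {τ | Below τ b m t} := by
      rw [hy, expectedBelow, ← Finset.mul_sum]; ring
    rw [this]
    simp only [integral_const, probReal_univ, smul_eq_mul, one_mul]
    gcongr with t
    exact integral_below_drift_le hζ.le hi.symm (h i hi) m t
  -- The queue of link b fed by itself stays empty, so it contributes 0.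
  set H : Fin net.L → net.Traffic → ℝ := fun i τ =>
    if i = b then 0 else (Real.log u + G i τ / u - 1) / Real.log ζ with hH
  have hHi : ∀ i, Integrable (H i) net.trafficMeasure := by
    intro i
    by_cases hi : i = b
    · simp [hH, hi]
    · simp only [hH, hi, if_false]
      exact (((integrable_const _).add ((hGi i).div_const _)).sub (integrable_const _)).div_const _
  have hHint : ∀ i, ∫ τ, H i τ ∂net.trafficMeasure ≤ (Real.log u + y / m) / Real.log ζ := by
    intro i
    by_cases hi : i = b
    · simp only [hH, hi, if_true, integral_zero]
      positivity
    · simp only [hH, hi, if_false]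
      have hadd : Integrable (fun τ => Real.log u + G i τ / u) net.trafficMeasure :=
        (integrable_const _).add ((hGi i).div_const _)
      rw [integral_div, integral_sub hadd (integrable_const _),
        integral_add (integrable_const _) ((hGi i).div_const _), integral_div]
      simp only [integral_const, probReal_univ, smul_eq_mul, one_mul]
      gcongr
      have h1 : (∫ τ, G i τ ∂net.trafficMeasure) / u ≤ 1 + y / m := by
        rw [div_le_iff₀ hu0]
        refine (hGint i hi).trans ?_
        have : (1 + y / m) * u = 2 + (ζ ^ 2 - 1) * m + 2 * (y / m) + (ζ ^ 2 - 1) * y := by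
          rw [hu]; field_simp; ring
        rw [this]
        have h2 : 0 ≤ (ζ ^ 2 - 1) * m := by positivity
        have h3 : 0 ≤ y / m := by positivity
        linarith
      linarith
  have hpt : ∀ τ : net.Traffic, ∑ t ∈ Finset.range n, belowInd b m t τ * (arr τ b t : ℝ)
      ≤ m + ∑ i, H i τ := by
    intro τ
    have e := sum_belowInd_mul_sub τ b m n fun t => ∑ s ∈ Finset.range t, (arr τ b s : ℝ)
    simp only [Finset.sum_range_succ, add_sub_cancel_left, Finset.sum_range_zero, sub_zero] at e
    rw [e]
    have h1 := sum_arr_stopIdx_le τ b m n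
    have h2 : ∑ s ∈ Finset.range (stopIdx τ b m n), (arr τ b s : ℝ)
        ≤ m + (queueLoss τ b (stopIdx τ b m n) : ℝ) := by exact_mod_cast h1
    refine h2.trans ?_
    gcongr
    rw [queueLoss, Finset.sum_range]
    push_cast
    refine Finset.sum_le_sum fun i _ => ?_
    by_cases hi : i = b
    · simp [hH, hi, queueMax_self]
    · simp only [hH, hi, if_false]
      rw [le_div_iff₀ hlog, hGstop]
      exact nat_mul_log_le hζ.le hu0 _ _
  have hAi : Integrable (fun τ : net.Traffic => ∑ t ∈ Finset.range n,
      belowInd b m t τ * (arr τ b t : ℝ)) net.trafficMeasure :=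
    integrable_finsetSum _ fun t _ =>
      (dependsOn_belowInd_mul_arr b m t).integrable (finite_pastSlots (t + 1))
  have hsum : Integrable (fun τ => ∑ i, H i τ) net.trafficMeasure :=
    integrable_finsetSum _ fun i _ => hHi i
  have key := integral_mono hAi ((integrable_const (m : ℝ)).add hsum) hpt
  rw [integral_sum_belowInd_mul_arr] at key
  simp only [Pi.add_apply] at key
  rw [integral_add (integrable_const _) hsum, integral_finsetSum _ fun i _ => hHi i] at key
  simp only [integral_const, probReal_univ, smul_eq_mul, one_mul] at key
  calc y ≤ m + ∑ i, ∫ τ, H i τ ∂net.trafficMeasure := key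
    _ ≤ m + ∑ _i : Fin net.L, (Real.log u + y / m) / Real.log ζ := by
        gcongr with i; exact hHint i
    _ = m + net.L / Real.log ζ * (Real.log u + y / m) := by
        simp; ring

/-- Explicit form of the bound when the queues are not too critical. -/
theorem expectedBelow_le_of_le {ζ κ : ℝ} (hζ : 1 < ζ) (b : Fin net.L)
    (h : ∀ i, i ≠ b → ζ ^ 2 * net.p b ≤ net.p i) (hκ : net.L / Real.log ζ ≤ κ) {m : ℕ}
    (hm : 0 < m) (hκm : 2 * κ ≤ m) (hκu : κ * Real.log (2 + (ζ ^ 2 - 1) * m) ≤ m) (n : ℕ) :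
    expectedBelow net b m n ≤ m + κ * (Real.log (2 + (ζ ^ 2 - 1) * m) + 4) := by
  have hm' : (0 : ℝ) < m := by exact_mod_cast hm
  have h1 := expectedBelow_le hζ b h hm n
  set y := expectedBelow net b m n
  have hy0 : 0 ≤ y := expectedBelow_nonneg b m n
  have hlogu : 0 ≤ Real.log (2 + (ζ ^ 2 - 1) * m) := by
    refine Real.log_nonneg ?_
    have : 0 ≤ (ζ ^ 2 - 1) * m := mul_nonneg (by nlinarith) hm'.le
    linarith
  have h2 : y ≤ m + κ * (Real.log (2 + (ζ ^ 2 - 1) * m) + y / m) :=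
    h1.trans (by gcongr)
  have h3 : κ * (y / m) ≤ y / 2 := by
    rw [mul_div_assoc', div_le_iff₀ hm']
    nlinarith
  -- A first pass gives y ≤ 2m + y/2; the resulting bound on y/m is fed back into `h2`.
  have h4 : y / m ≤ 4 := by
    rw [div_le_iff₀ hm']
    linarith
  have hκ0 : 0 ≤ κ := le_trans (div_nonneg (Nat.cast_nonneg _) (Real.log_nonneg hζ.le)) hκ
  exact h2.trans (by gcongr)

/-- Crude, but free of the logarithmic condition, so it applies at all levels m + i + 1 in the
excess sum. -/
theorem expectedBelow_le_sq {ζ κ : ℝ} (hζ : 1 < ζ) (hζ' : ζ ^ 2 ≤ 2) (b : Fin net.L)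
    (h : ∀ i, i ≠ b → ζ ^ 2 * net.p b ≤ net.p i) (hκ : net.L / Real.log ζ ≤ κ) {m : ℕ}
    (hm : 0 < m) (hκm : 2 * κ ≤ m) (n : ℕ) :
    expectedBelow net b m n ≤ 6 * (m : ℝ) ^ 2 := by
  have hm' : (1 : ℝ) ≤ m := by exact_mod_cast hm
  have h1 := expectedBelow_le hζ b h hm n
  set y := expectedBelow net b m n
  have hy0 : 0 ≤ y := expectedBelow_nonneg b m n
  have hu : 0 < 2 + (ζ ^ 2 - 1) * m := by
    have : 0 ≤ (ζ ^ 2 - 1) * (m : ℝ) := mul_nonneg (by nlinarith) (by linarith)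
    linarith
  have hlogu : Real.log (2 + (ζ ^ 2 - 1) * m) ≤ 1 + m := by
    refine (Real.log_le_sub_one_of_pos hu).trans ?_
    nlinarith
  have hκ0 : 0 ≤ κ := le_trans (div_nonneg (Nat.cast_nonneg _) (Real.log_nonneg hζ.le)) hκ
  have hlogu0 : 0 ≤ Real.log (2 + (ζ ^ 2 - 1) * m) := by
    refine Real.log_nonneg ?_
    have : 0 ≤ (ζ ^ 2 - 1) * (m : ℝ) := mul_nonneg (by nlinarith) (by linarith)
    linarith
  have h2 : y ≤ m + κ * (1 + m + y / m) :=
    h1.trans (by gcongr)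
  have h3 : κ * (y / m) ≤ y / 2 := by
    rw [mul_div_assoc', div_le_iff₀ (by linarith)]
    nlinarith
  nlinarith

end LineNetwork

/-! ### Codes: the frontier of a functional and its martingale -/

namespace LineNetwork

variable {net : LineNetwork} {k : ℕ}

/-- The coefficients used in the slots before `n`. -/
def CoeffIndex.Before (n : ℕ) : net.CoeffIndex k → Prop
  | .source t _ => t < n
  | .relay _ t s => t < n ∧ s < n

theorem finite_before (n : ℕ) : {a : net.CoeffIndex k | a.Before n}.Finite := by
  have h1 : (Set.range fun q : Fin n × Fin k => (CoeffIndex.source q.1 q.2 : net.CoeffIndex k)).Finite :=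
    Set.finite_range _
  have h2 : (Set.range fun q : Fin net.L × Fin n × Fin n =>
      (CoeffIndex.relay q.1 q.2.1 q.2.2 : net.CoeffIndex k)).Finite := Set.finite_range _
  refine (h1.union h2).subset fun a ha => ?_
  cases a with
  | source t j => exact Or.inl ⟨(⟨t, ha⟩, j), rfl⟩
  | relay i t s => exact Or.inr ⟨(i, ⟨t, ha.1⟩, ⟨s, ha.2⟩), rfl⟩

theorem globalVec_congr {c c' : net.Code k} {n : ℕ} (h : ∀ a, CoeffIndex.Before n a → c a = c' a)
    (τ : net.Traffic) : ∀ (i : ℕ) (hi : i < net.L) (t : ℕ), t < n →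
      globalVec c τ i hi t = globalVec c' τ i hi t
  | 0, _, t, ht => by
    funext j
    exact h (.source t j) ht
  | i + 1, hi, t, ht => by
    simp only [globalVec]
    refine Finset.sum_congr rfl fun s hs => ?_
    have hst : s < t := Finset.mem_range.1 hs
    rw [globalVec_congr h τ i _ s (hst.trans ht), h (.relay _ t s) ⟨ht, hst.trans ht⟩]

/-- Component along the functional `x` of the packet sent over link `i` in slot `t`. -/
noncomputable def sentBit (c : net.Code k) (τ : net.Traffic) (x : Fin k → ZMod 2) (i t : ℕ) :
    ZMod 2 :=
  if h : i < net.L then x ⬝ᵥ globalVec c τ i h t else 0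

theorem sentBit_congr {c c' : net.Code k} {n : ℕ} (h : ∀ a, CoeffIndex.Before n a → c a = c' a)
    (τ : net.Traffic) (x : Fin k → ZMod 2) (i : ℕ) {t : ℕ} (ht : t < n) :
    sentBit c τ x i t = sentBit c' τ x i t := by
  unfold sentBit
  split_ifs with hi
  · rw [globalVec_congr h τ i hi t ht]
  · rfl

theorem sentBit_zero (c : net.Code k) (τ : net.Traffic) (x : Fin k → ZMod 2) (t : ℕ) :
    sentBit c τ x 0 t = ∑ j, x j * c (.source t j) := by
  rw [sentBit, dif_pos net.L_pos]
  rfl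

theorem sentBit_succ (c : net.Code k) (τ : net.Traffic) (x : Fin k → ZMod 2) {i : ℕ}
    (hi : i + 1 < net.L) (t : ℕ) :
    sentBit c τ x (i + 1) t = ∑ s ∈ Finset.range t,
      if arr τ i s = 1 then c (.relay ⟨i + 1, hi⟩ t s) * sentBit c τ x i s else 0 := by
  have hi' : i < net.L := Nat.lt_of_succ_lt hi
  rw [sentBit, dif_pos hi]
  simp only [globalVec]
  rw [dotProduct_sum]
  refine Finset.sum_congr rfl fun s _ => ?_
  have harr : arr τ i s = 1 ↔ τ (⟨i, hi'⟩, s) = true := by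
    simp [arr, hi']
  by_cases h : τ (⟨i, hi'⟩, s) = true
  · rw [if_pos h, if_pos (harr.2 h), dotProduct_smul, smul_eq_mul, sentBit, dif_pos hi']
  · rw [if_neg h, if_neg (fun h' => h (harr.1 h')), dotProduct_zero]

open Classical in
/-- A node that has surely received, by time `n`, a packet not annihilated by the functional `x`:
the furthest one reached by passing such packets on one link at a time. -/
noncomputable def frontier (c : net.Code k) (τ : net.Traffic) (x : Fin k → ZMod 2) : ℕ → ℕ
  | 0 => 0
  | n + 1 =>
    if arr τ (frontier c τ x n) n = 1 ∧ sentBit c τ x (frontier c τ x n) n ≠ 0 then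
      frontier c τ x n + 1
    else frontier c τ x n

theorem frontier_succ_eq_or (c : net.Code k) (τ : net.Traffic) (x : Fin k → ZMod 2) (n : ℕ) :
    frontier c τ x (n + 1) = frontier c τ x n ∨
      frontier c τ x (n + 1) = frontier c τ x n + 1 := by
  rw [frontier]
  split_ifs
  · exact Or.inr rfl
  · exact Or.inl rfl

theorem lt_of_arr_eq_one {τ : net.Traffic} {i t : ℕ} (h : arr τ i t = 1) : i < net.L := by
  by_contra hi
  simp [arr, hi] at h

theorem frontier_le (c : net.Code k) (τ : net.Traffic) (x : Fin k → ZMod 2) (n : ℕ) :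
    frontier c τ x n ≤ net.L := by
  induction n with
  | zero => exact Nat.zero_le _
  | succ n ih =>
    rw [frontier]
    split_ifs with h
    · exact lt_of_arr_eq_one h.1
    · exact ih

theorem exists_sentBit_of_frontier {c : net.Code k} {τ : net.Traffic} {x : Fin k → ZMod 2}
    {n i : ℕ} (h : frontier c τ x n = i + 1) :
    ∃ s < n, arr τ i s = 1 ∧ sentBit c τ x i s ≠ 0 := by
  induction n with
  | zero => simp [frontier] at h
  | succ n ih =>
    rw [frontier] at h
    split_ifs at h with h'
    · obtain rfl : frontier c τ x n = i := by omega
      exact ⟨n, n.lt_succ_self, h'⟩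
    · obtain ⟨s, hs, hs'⟩ := ih h
      exact ⟨s, hs.trans n.lt_succ_self, hs'⟩

theorem frontier_congr {c c' : net.Code k} {n : ℕ} (h : ∀ a, CoeffIndex.Before n a → c a = c' a)
    (τ : net.Traffic) (x : Fin k → ZMod 2) : ∀ {t : ℕ}, t ≤ n →
      frontier c τ x t = frontier c' τ x t
  | 0, _ => rfl
  | t + 1, ht => by
    rw [frontier, frontier, frontier_congr h τ x (Nat.le_of_succ_le ht), sentBit_congr h τ x _ ht]

/-- A proper span lies in the kernel of a nonzero functional. A frontier at the sink would exhibit a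
received vector outside that kernel. -/
theorem exists_frontier_lt_of_not_decodable {c : net.Code k} {τ : net.Traffic} {n : ℕ}
    (h : ¬ Decodable c τ n) : ∃ x : Fin k → ZMod 2, x ≠ 0 ∧ frontier c τ x n < net.L := by
  obtain ⟨f, hf0, hf⟩ := Submodule.exists_le_ker_of_lt_top _ (lt_top_iff_ne_top.2 h)
  set x : Fin k → ZMod 2 := fun j => f (Pi.single j 1) with hx
  have hfx : ∀ v, f v = x ⬝ᵥ v := by
    intro v
    conv_lhs => rw [← Finset.univ_sum_single v]
    rw [map_sum]
    refine Finset.sum_congr rfl fun j _ => ?_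
    have : (Pi.single j (v j) : Fin k → ZMod 2) = v j • Pi.single j 1 := by
      rw [← Pi.single_smul, smul_eq_mul, mul_one]
    rw [this, map_smul, smul_eq_mul, mul_comm]
  refine ⟨x, fun h0 => hf0 (LinearMap.ext fun v => by simp [hfx, h0]), ?_⟩
  refine lt_of_le_of_ne (frontier_le c τ x n) fun hL => ?_
  obtain ⟨s, hs, ha, hb⟩ := exists_sentBit_of_frontier (i := net.L - 1)
    (hL.trans (Nat.sub_add_cancel net.L_pos).symm)
  have hlt : net.L - 1 < net.L := lt_of_arr_eq_one ha
  rw [sentBit, dif_pos hlt] at hb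
  refine hb ?_
  rw [← hfx]
  refine hf (Submodule.subset_span ⟨s, hs, ?_, rfl⟩)
  simpa [arr, hlt, lastLink] using ha

/-! ### Flipping one coefficient -/

/-- First slot in which a packet showing that the frontier has been reached was sent. -/
noncomputable def witnessSlot (c : net.Code k) (τ : net.Traffic) (x : Fin k → ZMod 2) (n : ℕ) : ℕ :=
  sInf {s | s < n ∧ arr τ (frontier c τ x n - 1) s = 1 ∧
    sentBit c τ x (frontier c τ x n - 1) s ≠ 0}

theorem witnessSlot_congr {c c' : net.Code k} {n : ℕ}
    (h : ∀ a, CoeffIndex.Before n a → c a = c' a) (τ : net.Traffic) (x : Fin k → ZMod 2) :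
    witnessSlot c τ x n = witnessSlot c' τ x n := by
  unfold witnessSlot
  congr 1
  ext s
  rw [frontier_congr h τ x le_rfl]
  simp only [Set.mem_ofPred_eq]
  refine and_congr_right fun hs => ?_
  rw [sentBit_congr h τ x _ hs]

/-- A coefficient of slot `n` on which the packet sent by the frontier node depends. -/
def flipIndex (net : LineNetwork) {k : ℕ} (n : ℕ) (j : Fin k) : ℕ × ℕ → net.CoeffIndex k
  | (0, _) => .source n j
  | (i + 1, s) => if h : i + 1 < net.L then .relay ⟨i + 1, h⟩ n s else .source n j

/-- So a flip leaves everything before slot n unchanged. This also covers the default value used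
once the frontier is the sink. -/
theorem not_before_flipIndex (n : ℕ) (j : Fin k) (q : ℕ × ℕ) :
    ¬ (flipIndex net n j q).Before n := by
  rcases q with ⟨_ | i, s⟩
  · exact lt_irrefl n
  · simp only [flipIndex]
    split_ifs
    · exact fun h => lt_irrefl n h.1
    · exact lt_irrefl n

theorem zmod_two_eq_one {a : ZMod 2} (h : a ≠ 0) : a = 1 := by
  revert a; decide

-- At the source, the flipped coefficient multiplies x_j = 1; at a relay, it multiplies the witness
-- packet, on which x is 1. Either way the bit sent is toggled.
open Classical in
theorem sentBit_add_single (c : net.Code k) (τ : net.Traffic) {x : Fin k → ZMod 2} {j : Fin k}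
    (hj : x j ≠ 0) {n : ℕ} (hL : frontier c τ x n < net.L) :
    sentBit (c + Pi.single (flipIndex net n j (frontier c τ x n, witnessSlot c τ x n)) 1) τ x
      (frontier c τ x n) n = sentBit c τ x (frontier c τ x n) n + 1 := by
  set a := flipIndex net n j (frontier c τ x n, witnessSlot c τ x n) with ha
  have hpast : ∀ a', CoeffIndex.Before n a' →
      (c + Pi.single a 1 : net.Code k) a' = c a' := by
    intro a' ha'
    have : a' ≠ a := fun h => not_before_flipIndex n j _ (h ▸ ha')
    simp [this]
  rcases hJ : frontier c τ x n with _ | i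
  · rw [hJ] at ha
    simp only [flipIndex] at ha
    rw [sentBit_zero, sentBit_zero]
    simp only [Pi.add_apply, mul_add, Finset.sum_add_distrib]
    congr 1
    rw [Finset.sum_eq_single j]
    · simp [ha, zmod_two_eq_one hj]
    · intro j' _ hj'
      have : (CoeffIndex.source n j' : net.CoeffIndex k) ≠ a := by
        rw [ha]; intro h; injection h with _ h; exact hj' h
      simp [this]
    · simp
  · have hi : i + 1 < net.L := hJ ▸ hL
    have hw : witnessSlot c τ x n ∈ {s | s < n ∧ arr τ (frontier c τ x n - 1) s = 1 ∧
        sentBit c τ x (frontier c τ x n - 1) s ≠ 0} := by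
      refine Nat.sInf_mem ?_
      obtain ⟨s, hs⟩ := exists_sentBit_of_frontier hJ
      exact ⟨s, by rw [hJ]; exact hs⟩
    rw [hJ] at ha hw
    simp only [flipIndex, hi, dif_pos] at ha
    set s₀ := witnessSlot c τ x n with hs₀
    obtain ⟨hs₀n, hs₀a, hs₀b⟩ := hw
    rw [Nat.add_sub_cancel] at hs₀a hs₀b
    rw [sentBit_succ _ _ _ hi, sentBit_succ _ _ _ hi]
    have hterm : ∀ s ∈ Finset.range n,
        (if arr τ i s = 1 then (c + Pi.single a 1 : net.Code k) (.relay ⟨i + 1, hi⟩ n s)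
          * sentBit (c + Pi.single a 1) τ x i s else 0)
        = (if arr τ i s = 1 then c (.relay ⟨i + 1, hi⟩ n s) * sentBit c τ x i s else 0)
          + (if s = s₀ then sentBit c τ x i s₀ else 0) := by
      intro s hs
      rw [sentBit_congr hpast τ x i (Finset.mem_range.1 hs)]
      by_cases hss : s = s₀
      · subst hss
        rw [if_pos hs₀a, if_pos hs₀a, if_pos rfl, Pi.add_apply, ha]
        simp [add_mul]
      · have : (CoeffIndex.relay ⟨i + 1, hi⟩ n s : net.CoeffIndex k) ≠ a := by
          rw [ha]; intro h; injection h with _ _ h; exact hss h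
        simp [this, hss]
    rw [Finset.sum_congr rfl hterm, Finset.sum_add_distrib]
    congr 1
    simp [hs₀n, zmod_two_eq_one hs₀b]

/-! ### The exponential supermartingale -/

/-- Packets received over the link that leaves the frontier. -/
noncomputable def frontierCount (c : net.Code k) (τ : net.Traffic) (x : Fin k → ZMod 2) (n : ℕ) :
    ℕ :=
  ∑ t ∈ Finset.range n, arr τ (frontier c τ x t) t

/-- Weight of a code; its mean does not grow with `n`. -/
noncomputable def codeWeight (β : ℝ) (τ : net.Traffic) (x : Fin k → ZMod 2) (n : ℕ)
    (c : net.Code k) : ℝ :=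
  β ^ frontierCount c τ x n * ((2 - β) / β) ^ frontier c τ x n

theorem codeWeight_congr {β : ℝ} {c c' : net.Code k} {n : ℕ}
    (h : ∀ a, CoeffIndex.Before n a → c a = c' a) (τ : net.Traffic) (x : Fin k → ZMod 2) :
    codeWeight β τ x n c = codeWeight β τ x n c' := by
  have : frontierCount c τ x n = frontierCount c' τ x n :=
    Finset.sum_congr rfl fun t ht => by rw [frontier_congr h τ x (Finset.mem_range.1 ht).le]
  rw [codeWeight, codeWeight, this, frontier_congr h τ x le_rfl]

theorem measurable_codeWeight (β : ℝ) (τ : net.Traffic) (x : Fin k → ZMod 2) (n : ℕ) :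
    Measurable (codeWeight (net := net) β τ x n) :=
  DependsOn.measurable (s := {a : net.CoeffIndex k | a.Before n})
    (fun _ _ h => codeWeight_congr h τ x) (finite_before n)

-- With a reception, exactly one of the two codes advances the frontier, and β(1 + (2-β)/β) = 2.
-- Without one, in particular when the frontier is the sink, neither weight changes.
open Classical in
theorem codeWeight_add_flip {β : ℝ} (hβ : 0 < β) (c : net.Code k) (τ : net.Traffic)
    {x : Fin k → ZMod 2} {j : Fin k} (hj : x j ≠ 0) (n : ℕ) :
    codeWeight β τ x (n + 1) c + codeWeight β τ x (n + 1)
      (c + Pi.single (flipIndex net n j (frontier c τ x n, witnessSlot c τ x n)) 1)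
      = 2 * codeWeight β τ x n c := by
  set c' := c + Pi.single (flipIndex net n j (frontier c τ x n, witnessSlot c τ x n)) 1 with hc'
  have hpast : ∀ a', CoeffIndex.Before n a' → c' a' = c a' := by
    intro a' ha'
    have : a' ≠ flipIndex net n j (frontier c τ x n, witnessSlot c τ x n) :=
      fun h => not_before_flipIndex n j _ (h ▸ ha')
    simp [hc', this]
  have hJ : frontier c' τ x n = frontier c τ x n := frontier_congr hpast τ x le_rfl
  have hZ : frontierCount c' τ x n = frontierCount c τ x n :=
    Finset.sum_congr rfl fun t ht => by rw [frontier_congr hpast τ x (Finset.mem_range.1 ht).le]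
  have hZ1 : ∀ c : net.Code k, frontierCount c τ x (n + 1)
      = frontierCount c τ x n + arr τ (frontier c τ x n) n := fun c => Finset.sum_range_succ _ _
  simp only [codeWeight, hZ1, hZ, hJ, frontier]
  rcases Nat.le_one_iff_eq_zero_or_eq_one.1 (arr_le_one τ (frontier c τ x n) n) with ha | ha
  · simp [ha]; ring
  · have hbit := sentBit_add_single c τ hj (lt_of_arr_eq_one ha)
    rw [← hc'] at hbit
    have hsum : β * ((2 - β) / β) = 2 - β := by field_simp
    by_cases hb : sentBit c τ x (frontier c τ x n) n = 0
    · have hb' : sentBit c' τ x (frontier c τ x n) n ≠ 0 := by rw [hbit, hb]; decide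
      rw [if_neg (fun h => h.2 hb), if_pos ⟨ha, hb'⟩, ha, pow_succ, pow_succ]
      linear_combination (β ^ frontierCount c τ x n * ((2 - β) / β) ^ frontier c τ x n) * hsum
    · have hb' : sentBit c' τ x (frontier c τ x n) n = 0 := by
        rw [hbit, zmod_two_eq_one hb]; rfl
      rw [if_pos ⟨ha, hb⟩, if_neg (fun h => h.2 hb'), ha, pow_succ, pow_succ]
      linear_combination (β ^ frontierCount c τ x n * ((2 - β) / β) ^ frontier c τ x n) * hsum

theorem lintegral_codeWeight_le {β : ℝ} (hβ : 0 < β) (hβ2 : β ≤ 2) (τ : net.Traffic)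
    {x : Fin k → ZMod 2} (hx : x ≠ 0) (n : ℕ) :
    ∫⁻ c, ENNReal.ofReal (codeWeight β τ x n c) ∂net.codeMeasure k ≤ 1 := by
  classical
  obtain ⟨j, hj⟩ := Function.ne_iff.1 hx
  induction n with
  | zero => simp [codeWeight, frontierCount, frontier]
  | succ n ih =>
    refine le_trans ?_ ih
    have hcongr : ∀ {c c' : net.Code k}, (∀ a, CoeffIndex.Before n a → c a = c' a) →
        (frontier c τ x n, witnessSlot c τ x n) = (frontier c' τ x n, witnessSlot c' τ x n) :=
      fun h => Prod.ext (frontier_congr h τ x le_rfl) (witnessSlot_congr h τ x)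
    have hnn : ∀ c n, 0 ≤ codeWeight β τ x n c := fun c n =>
      mul_nonneg (by positivity) (pow_nonneg (div_nonneg (by linarith) hβ.le) _)
    refine lintegral_le_of_flip (e := fun c : net.Code k =>
      (frontier c τ x n, witnessSlot c τ x n)) ?_ (flipIndex net n j) (fun c => ?_)
      (measurable_codeWeight β τ x (n + 1)).ennreal_ofReal fun c => ?_
    · exact DependsOn.measurable (s := {a : net.CoeffIndex k | a.Before n})
        (fun _ _ h => hcongr h) (finite_before n)
    · refine hcongr fun a ha => ?_
      have : a ≠ flipIndex net n j (frontier c τ x n, witnessSlot c τ x n) :=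
        fun h => not_before_flipIndex n j _ (h ▸ ha)
      simp [this]
    · rw [← ENNReal.ofReal_add (hnn _ _) (hnn _ _), codeWeight_add_flip hβ c τ hj n,
        ENNReal.ofReal_mul zero_le_two, ENNReal.ofReal_ofNat]

/-- The path inequality is applied at the time n' where `Below` fails. Up to n' the path has visited
only actual links, so its queues are all part of the queueing loss. -/
theorem le_frontierCount {c : net.Code k} {τ : net.Traffic} {x : Fin k → ZMod 2} {b m n : ℕ}
    (h : ¬ Below τ b m n) (hx : frontier c τ x n < net.L) : m ≤ frontierCount c τ x n := by
  unfold Below at h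
  push Not at h
  obtain ⟨n', hn', h⟩ := h
  have hmono : Monotone (frontier c τ x) := monotone_nat_of_le_succ fun t => by
    rcases frontier_succ_eq_or c τ x t with h | h <;> omega
  have hJ : frontier c τ x n' < net.L := (hmono hn').trans_lt hx
  have h1 := sum_le_sum_path_add_queueMax (arr τ) b (frontier c τ x)
    (frontier_succ_eq_or c τ x) n'
  have h2 : ∑ i ∈ Finset.range (frontier c τ x n'), queueMax (arr τ b) (arr τ i) n'
      + queueLen (arr τ b) (arr τ (frontier c τ x n')) n' ≤ queueLoss τ b n' := by
    have h3 := queueLen_le_queueMax (arr τ b) (arr τ (frontier c τ x n')) n'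
    have h4 : ∑ i ∈ Finset.range (frontier c τ x n' + 1), queueMax (arr τ b) (arr τ i) n'
        ≤ queueLoss τ b n' :=
      Finset.sum_le_sum_of_subset (Finset.range_subset_range.2 hJ)
    rw [Finset.sum_range_succ] at h4
    omega
  have h5 : ∑ t ∈ Finset.range n', arr τ (frontier c τ x t) t ≤ frontierCount c τ x n :=
    Finset.sum_le_sum_of_subset (Finset.range_subset_range.2 hn')
  omega

/-- Given enough received packets, decoding fails with exponentially small probability. -/
theorem codeMeasure_not_decodable_le {β : ℝ} (hβ : 1 ≤ β) (hβ2 : β < 2) {τ : net.Traffic}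
    {b m n : ℕ} (h : ¬ Below τ b m n) :
    net.codeMeasure k {c | ¬ Decodable c τ n}
      ≤ ENNReal.ofReal (2 ^ k * (β / (2 - β)) ^ net.L / β ^ m) := by
  classical
  have hβ0 : 0 < β := by linarith
  have hK : 0 < (2 - β) / β := div_pos (by linarith) hβ0
  have hK1 : (2 - β) / β ≤ 1 := by rw [div_le_one hβ0]; linarith
  set w : ℝ := β ^ m * ((2 - β) / β) ^ net.L with hw
  have hw0 : 0 < w := by positivity
  have hx : ∀ x : Fin k → ZMod 2, x ≠ 0 →
      net.codeMeasure k {c | frontier c τ x n < net.L} ≤ ENNReal.ofReal w⁻¹ := by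
    intro x hx
    have hsub : {c : net.Code k | frontier c τ x n < net.L}
        ⊆ {c | ENNReal.ofReal w ≤ ENNReal.ofReal (codeWeight β τ x n c)} := by
      intro c hc
      refine ENNReal.ofReal_le_ofReal ?_
      exact mul_le_mul (pow_le_pow_right₀ hβ (le_frontierCount h hc))
        (pow_le_pow_of_le_one hK.le hK1 (le_of_lt hc)) (by positivity) (by positivity)
    refine (measure_mono hsub).trans ?_
    refine (meas_ge_le_lintegral_div (measurable_codeWeight β τ x n).ennreal_ofReal.aemeasurable
      (by simpa using hw0) ENNReal.ofReal_ne_top).trans ?_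
    rw [ENNReal.ofReal_inv_of_pos hw0, ← one_div]
    gcongr
    exact lintegral_codeWeight_le hβ0 hβ2.le τ hx n
  have hsub : {c : net.Code k | ¬ Decodable c τ n}
      ⊆ ⋃ x ∈ (Finset.univ.erase (0 : Fin k → ZMod 2)), {c | frontier c τ x n < net.L} := by
    intro c hc
    obtain ⟨x, hx0, hx⟩ := exists_frontier_lt_of_not_decodable hc
    simp only [Set.mem_iUnion]
    exact ⟨x, by simpa using hx0, hx⟩
  calc net.codeMeasure k {c | ¬ Decodable c τ n}
      ≤ ∑ x ∈ Finset.univ.erase (0 : Fin k → ZMod 2),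
          net.codeMeasure k {c | frontier c τ x n < net.L} :=
        (measure_mono hsub).trans (measure_biUnion_finset_le _ _)
    _ ≤ ∑ x ∈ Finset.univ.erase (0 : Fin k → ZMod 2), ENNReal.ofReal w⁻¹ :=
        Finset.sum_le_sum fun x hxm => hx x (by simpa using hxm)
    _ ≤ ∑ x : Fin k → ZMod 2, ENNReal.ofReal w⁻¹ :=
        Finset.sum_le_sum_of_subset (Finset.erase_subset _ _)
    _ = ENNReal.ofReal (2 ^ k * (β / (2 - β)) ^ net.L / β ^ m) := by
        have : 2 ^ k * (β / (2 - β)) ^ net.L / β ^ m = 2 ^ k * w⁻¹ := by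
          rw [hw, mul_inv, ← inv_pow ((2 - β) / β), inv_div]; field_simp
        rw [this, ENNReal.ofReal_mul (by positivity)]
        simp [ENNReal.ofReal_pow]

end LineNetwork

/-! ### From failure probabilities to the average delay -/

namespace LineNetwork

variable {net : LineNetwork} {k : ℕ}

theorem codingDelay_le_tsum (c : net.Code k) (τ : net.Traffic) :
    codingDelay c τ ≤ ∑' n, Set.indicator {τ | ¬ Decodable c τ n} 1 τ := by
  classical
  by_cases h : ∃ n, Decodable c τ n
  · calc codingDelay c τ ≤ (Nat.find h : ℝ≥0∞) := iInf₂_le _ (Nat.find_spec h)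
      _ = ∑ n ∈ Finset.range (Nat.find h), Set.indicator {τ | ¬ Decodable c τ n} 1 τ := by
        rw [Finset.sum_congr rfl fun n hn => Set.indicator_of_mem
          (s := {τ : net.Traffic | ¬ Decodable c τ n}) (Nat.find_min h (Finset.mem_range.1 hn)) 1]
        simp
      _ ≤ _ := ENNReal.sum_le_tsum _
  · push Not at h
    have : ∀ n, Set.indicator {τ : net.Traffic | ¬ Decodable c τ n} (1 : net.Traffic → ℝ≥0∞) τ = 1 :=
      fun n => Set.indicator_of_mem (s := {τ : net.Traffic | ¬ Decodable c τ n}) (h n) 1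
    simp [this]

theorem globalVec_congr_traffic (c : net.Code k) {τ τ' : net.Traffic} {n : ℕ}
    (h : ∀ x ∈ pastSlots net n, τ x = τ' x) : ∀ (i : ℕ) (hi : i < net.L) (t : ℕ), t ≤ n →
      globalVec c τ i hi t = globalVec c τ' i hi t
  | 0, _, _, _ => rfl
  | i + 1, hi, t, ht => by
    simp only [globalVec]
    refine Finset.sum_congr rfl fun s hs => ?_
    have hst : s < n := (Finset.mem_range.1 hs).trans_le ht
    rw [globalVec_congr_traffic c h i _ s hst.le, h (⟨i, _⟩, s) hst]

theorem decodable_congr_traffic (c : net.Code k) {τ τ' : net.Traffic} {n : ℕ}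
    (h : ∀ x ∈ pastSlots net n, τ x = τ' x) : Decodable c τ n ↔ Decodable c τ' n := by
  unfold Decodable
  have : {v : Fin k → ZMod 2 | ∃ t < n, τ (lastLink net, t) = true ∧
        v = globalVec c τ (lastLink net) (lastLink net).isLt t}
      = {v : Fin k → ZMod 2 | ∃ t < n, τ' (lastLink net, t) = true ∧
        v = globalVec c τ' (lastLink net) (lastLink net).isLt t} := by
    ext v
    refine exists_congr fun t => and_congr_right fun ht => ?_
    rw [globalVec_congr_traffic c h _ _ t (le_of_lt ht), h (lastLink net, t) ht]
  rw [this]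

theorem decodable_congr_code {c c' : net.Code k} (τ : net.Traffic) {n : ℕ}
    (h : ∀ a, CoeffIndex.Before n a → c a = c' a) : Decodable c τ n ↔ Decodable c' τ n := by
  unfold Decodable
  have : {v : Fin k → ZMod 2 | ∃ t < n, τ (lastLink net, t) = true ∧
        v = globalVec c τ (lastLink net) (lastLink net).isLt t}
      = {v : Fin k → ZMod 2 | ∃ t < n, τ (lastLink net, t) = true ∧
        v = globalVec c' τ (lastLink net) (lastLink net).isLt t} := by
    ext v
    refine exists_congr fun t => and_congr_right fun ht => ?_
    rw [globalVec_congr h τ _ _ t ht]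
  rw [this]

/-- Joint measurability permits exchanging the averages over codes and losses. -/
theorem measurableSet_decodable (n : ℕ) :
    MeasurableSet {q : net.Code k × net.Traffic | Decodable q.1 q.2 n} :=
  measurableSet_setOfPred.2 <| measurable_prod_of_dependsOn
    (f := fun (c : net.Code k) (τ : net.Traffic) => Decodable c τ n)
    (finite_before n) (finite_pastSlots n)
    (fun τ _ _ h => propext (decodable_congr_code τ h))
    (fun c _ _ h => propext (decodable_congr_traffic c h))

/-- Pairs of a code and a traffic for which decoding fails at time `n` although `Below` fails. -/
def badSet (net : LineNetwork) (k b m n : ℕ) : Set (net.Code k × net.Traffic) :=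
  {q | ¬ Decodable q.1 q.2 n ∧ ¬ Below q.2 b m n}

theorem measurableSet_badSet (b m n : ℕ) : MeasurableSet (badSet net k b m n) :=
  (measurableSet_decodable n).compl.inter (measurable_snd (measurableSet_below b m n)).compl

/-- Expected excess of the delay of a code over the time at which `Below` fails. -/
noncomputable def excess (b m : ℕ) (c : net.Code k) : ℝ≥0∞ :=
  ∑' n, net.trafficMeasure (Prod.mk c ⁻¹' badSet net k b m n)

theorem measurable_excess (b m : ℕ) : Measurable (excess (net := net) (k := k) b m) :=
  Measurable.tsum fun n => measurable_measure_prodMk_left (measurableSet_badSet b m n)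

/-- The first sum does not depend on the code, so only the excess needs Markov's inequality. -/
theorem avgCodingDelay_le (b m : ℕ) (c : net.Code k) :
    avgCodingDelay c ≤ ∑' n, net.trafficMeasure {τ | Below τ b m n} + excess b m c := by
  have hmeas : ∀ n, MeasurableSet {τ : net.Traffic | ¬ Decodable c τ n} := fun n =>
    (measurable_prodMk_left (measurableSet_decodable n)).compl
  calc avgCodingDelay c
      ≤ ∫⁻ τ, ∑' n, Set.indicator {τ | ¬ Decodable c τ n} 1 τ ∂net.trafficMeasure :=
        lintegral_mono (codingDelay_le_tsum c)
    _ = ∑' n, net.trafficMeasure {τ | ¬ Decodable c τ n} := by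
        rw [lintegral_tsum fun n => (measurable_one.indicator (hmeas n)).aemeasurable]
        exact tsum_congr fun n => lintegral_indicator_one (hmeas n)
    _ ≤ ∑' n, (net.trafficMeasure {τ | Below τ b m n}
          + net.trafficMeasure (Prod.mk c ⁻¹' badSet net k b m n)) := by
        refine ENNReal.tsum_le_tsum fun n => (measure_mono fun τ hτ => ?_).trans
          (measure_union_le _ _)
        by_cases h : Below τ b m n
        · exact Or.inl h
        · exact Or.inr ⟨hτ, h⟩
    _ = _ := ENNReal.tsum_add

/-- At most n packets arrive in n slots, so `Below` holds at high levels and there is a level where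
it switches. -/
theorem exists_below_of_not_below {τ : net.Traffic} {b m n : ℕ} (h : ¬ Below τ b m n) :
    ∃ i, ¬ Below τ b (m + i) n ∧ Below τ b (m + i + 1) n := by
  by_contra! hcon
  have hall : ∀ i, ¬ Below τ b (m + i) n := by
    intro i
    induction i with
    | zero => exact h
    | succ i ih => exact hcon i ih
  refine hall (n + 1) fun n' hn' => ?_
  have : ∑ t ∈ Finset.range n', arr τ b t ≤ ∑ _t ∈ Finset.range n', 1 :=
    Finset.sum_le_sum fun t _ => arr_le_one τ b t
  simp at this
  omega

/-- The bad event is split by the level m + i just reached: the failure bound there is weighted by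
the expected time spent below m + i + 1. -/
theorem lintegral_excess_le {β : ℝ} (hβ : 1 ≤ β) (hβ2 : β < 2) (b m : ℕ) :
    ∫⁻ c, excess b m c ∂net.codeMeasure k
      ≤ ∑' i, ENNReal.ofReal (2 ^ k * (β / (2 - β)) ^ net.L / β ^ (m + i))
        * ∑' n, net.trafficMeasure {τ | Below τ b (m + i + 1) n} := by
  have hB := measurableSet_below (net := net) b
  calc ∫⁻ c, excess b m c ∂net.codeMeasure k
      = ∑' n, ((net.codeMeasure k).prod net.trafficMeasure) (badSet net k b m n) := by
        unfold excess
        rw [lintegral_tsum fun n =>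
          (measurable_measure_prodMk_left (measurableSet_badSet b m n)).aemeasurable]
        exact tsum_congr fun n => (Measure.prod_apply (measurableSet_badSet b m n)).symm
    _ ≤ ∑' n, ∫⁻ τ, ∑' i, Set.indicator {τ | Below τ b (m + i + 1) n}
          (fun _ => ENNReal.ofReal (2 ^ k * (β / (2 - β)) ^ net.L / β ^ (m + i))) τ
          ∂net.trafficMeasure := by
        refine ENNReal.tsum_le_tsum fun n => ?_
        rw [Measure.prod_apply_symm (measurableSet_badSet b m n)]
        refine lintegral_mono fun τ => ?_
        by_cases h : Below τ b m n
        · have : (fun c : net.Code k => (c, τ)) ⁻¹' badSet net k b m n = ∅ := by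
            ext c; simp [badSet, h]
          simp [this]
        · obtain ⟨i, hi, hi'⟩ := exists_below_of_not_below h
          refine le_trans ?_ (ENNReal.le_tsum i)
          rw [Set.indicator_of_mem (s := {τ : net.Traffic | Below τ b (m + i + 1) n}) hi']
          exact (measure_mono fun c hc => hc.1).trans (codeMeasure_not_decodable_le hβ hβ2 hi)
    _ = ∑' n, ∑' i, ENNReal.ofReal (2 ^ k * (β / (2 - β)) ^ net.L / β ^ (m + i))
        * net.trafficMeasure {τ | Below τ b (m + i + 1) n} := by
        refine tsum_congr fun n => ?_
        rw [lintegral_tsum fun i => (measurable_const.indicator (hB _ n)).aemeasurable]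
        exact tsum_congr fun i => lintegral_indicator_const (hB _ n) _
    _ = _ := by
        rw [ENNReal.tsum_comm]
        exact tsum_congr fun i => ENNReal.tsum_mul_left

theorem tsum_below_le {b : Fin net.L} {m : ℕ} {Y : ℝ} (hY : ∀ n, expectedBelow net b m n ≤ Y) :
    ∑' n, net.trafficMeasure {τ | Below τ b m n} ≤ ENNReal.ofReal (Y / net.p b) := by
  rw [ENNReal.tsum_eq_iSup_nat]
  refine iSup_le fun n => ?_
  rw [Finset.sum_congr rfl fun t _ => (ofReal_measureReal
    (μ := net.trafficMeasure) (s := {τ : net.Traffic | Below τ b m t})).symm,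
    ← ENNReal.ofReal_sum_of_nonneg fun _ _ => measureReal_nonneg]
  refine ENNReal.ofReal_le_ofReal ?_
  rw [le_div_iff₀ (net.p_pos b), mul_comm]
  exact hY n

/-- With β = 2 - 1/m, Bernoulli's inequality keeps β^m above 2^m/2, while β/(2-β) = 2m - 1 costs
only a polynomial factor per link. -/
theorem excess_term_le {m : ℕ} (hm : 2 ≤ m) (k L i : ℕ) :
    2 ^ k * (((2 : ℝ) - 1 / m) / (2 - (2 - 1 / m))) ^ L / (2 - 1 / m) ^ (m + i)
        * (6 * ((m + i + 1 : ℕ) : ℝ) ^ 2)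
      ≤ 192 * (2 ^ k * (2 * (m : ℝ)) ^ (L + 2) / 2 ^ m) * (27 / 32) ^ i := by
  have hm' : (2 : ℝ) ≤ m := by exact_mod_cast hm
  have hm0 : (0 : ℝ) < m := by linarith
  have hδ : 1 / (m : ℝ) ≤ 1 / 2 := by gcongr
  have hδ0 : 0 < 1 / (m : ℝ) := by positivity
  set β : ℝ := 2 - 1 / m with hβ
  have hβ1 : 3 / 2 ≤ β := by linarith
  have h1 : β / (2 - β) ≤ 2 * m := by
    have : 2 - β = 1 / m := by rw [hβ]; ring
    rw [this, div_div_eq_mul_div, div_one]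
    nlinarith
  have h1' : 0 ≤ β / (2 - β) := div_nonneg (by linarith) (by linarith)
  have h2 : 2 ^ m / 2 ≤ β ^ m := by
    have hb := one_add_mul_le_pow (a := -(1 / (2 * (m : ℝ)))) (by
      have : 1 / (2 * (m : ℝ)) ≤ 1 := by rw [div_le_one (by linarith)]; linarith
      linarith) m
    have e : 1 + (m : ℝ) * -(1 / (2 * (m : ℝ))) = 1 / 2 := by field_simp; norm_num
    rw [e] at hb
    have e2 : β = 2 * (1 + -(1 / (2 * (m : ℝ)))) := by rw [hβ]; field_simp; ring
    rw [e2, mul_pow]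
    have : (0 : ℝ) < 2 ^ m := by positivity
    nlinarith
  have h3 : (3 / 2 : ℝ) ^ i ≤ β ^ i := by gcongr
  -- The quadratic factor is traded for (9/8)^(2i), which the decay (3/2)^(-i) beats with ratio
  -- 27/32.
  have h4 : ((m + i + 1 : ℕ) : ℝ) ^ 2 ≤ m ^ 2 * (64 * (81 / 64) ^ i) := by
    have hb := one_add_mul_le_pow (a := (1 / 8 : ℝ)) (by norm_num) i
    have e : (64 : ℝ) * (81 / 64) ^ i = (8 * (1 + 1 / 8) ^ i) ^ 2 := by
      rw [mul_pow, ← pow_mul, mul_comm i 2, pow_mul]; norm_num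
    rw [e, ← mul_pow]
    have hi0 : (0 : ℝ) ≤ i := Nat.cast_nonneg i
    have h5 : (m : ℝ) * (8 * (1 + i * (1 / 8))) ≤ m * (8 * (1 + 1 / 8) ^ i) := by gcongr
    have h6 : ((m + i + 1 : ℕ) : ℝ) ≤ m * (8 * (1 + i * (1 / 8))) := by
      push_cast; nlinarith
    exact pow_le_pow_left₀ (Nat.cast_nonneg _) (h6.trans h5) 2
  have h27 : (27 / 32 : ℝ) ^ i = (81 / 64) ^ i / (3 / 2) ^ i := by
    rw [← div_pow]; norm_num
  calc 2 ^ k * (β / (2 - β)) ^ L / β ^ (m + i) * (6 * ((m + i + 1 : ℕ) : ℝ) ^ 2)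
      ≤ 2 ^ k * (2 * (m : ℝ)) ^ L / (2 ^ m / 2 * (3 / 2) ^ i) * (6 * (m ^ 2 * (64 * (81 / 64) ^ i))) := by
        rw [pow_add]
        gcongr
    _ = 192 * (2 ^ k * (2 * (m : ℝ)) ^ (L + 2) / 2 ^ m) * (27 / 32) ^ i := by
        rw [h27]; field_simp; ring

/-- Tail bound for the average coding delay of a random dense code, with explicit conditions. -/
theorem codeMeasure_avgCodingDelay_le {ζ κ X ε : ℝ} (hζ : 1 < ζ) (hζ' : ζ ^ 2 ≤ 2) (b : Fin net.L)
    (h : ∀ i, i ≠ b → ζ ^ 2 * net.p b ≤ net.p i) (hκ : net.L / Real.log ζ ≤ κ) {m : ℕ}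
    (hm : 2 ≤ m) (hκm : 2 * κ ≤ m) (hκu : κ * Real.log (2 + (ζ ^ 2 - 1) * m) ≤ m)
    (hX : 0 < X) (hY : m + κ * (Real.log (2 + (ζ ^ 2 - 1) * m) + 4) ≤ k + X / 2)
    (hε : 2458 * (2 ^ k * (2 * (m : ℝ)) ^ (net.L + 2) / 2 ^ m) ≤ ε * X) :
    net.codeMeasure k {c | ENNReal.ofReal ((1 / net.p b) * (k + X)) < avgCodingDelay c}
      ≤ ENNReal.ofReal ε := by
  have hp := net.p_pos b
  have hm' : (2 : ℝ) ≤ m := by exact_mod_cast hm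
  have hterm := excess_term_le hm k net.L
  have hA0 : 0 ≤ 2 ^ k * (2 * (m : ℝ)) ^ (net.L + 2) / 2 ^ m := by positivity
  generalize 2 ^ k * (2 * (m : ℝ)) ^ (net.L + 2) / 2 ^ m = A at hε hterm hA0
  have hδ : 1 / (m : ℝ) ≤ 1 / 2 := by gcongr
  have hδ0 : 0 < 1 / (m : ℝ) := by positivity
  have hsum1 : ∑' n, net.trafficMeasure {τ | Below τ b m n}
      ≤ ENNReal.ofReal ((k + X / 2) / net.p b) :=
    tsum_below_le fun n => (expectedBelow_le_of_le hζ b h hκ (by omega) hκm hκu n).trans hY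
  have hgeo : HasSum (fun i : ℕ => 192 * A * (27 / 32 : ℝ) ^ i / net.p b)
      (192 * A * (1 - 27 / 32)⁻¹ / net.p b) :=
    ((hasSum_geometric_of_lt_one (by norm_num) (by norm_num)).mul_left _).div_const _
  have hexc : ∫⁻ c, excess b m c ∂net.codeMeasure k ≤ ENNReal.ofReal (ε * (X / (2 * net.p b))) := by
    calc ∫⁻ c, excess b m c ∂net.codeMeasure k
        ≤ ∑' i, ENNReal.ofReal (2 ^ k * ((2 - 1 / (m : ℝ)) / (2 - (2 - 1 / m))) ^ net.L
            / (2 - 1 / m) ^ (m + i))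
          * ∑' n, net.trafficMeasure {τ | Below τ b (m + i + 1) n} :=
          lintegral_excess_le (by linarith) (by linarith) b m
      _ ≤ ∑' i : ℕ, ENNReal.ofReal (192 * A * (27 / 32) ^ i / net.p b) := by
          refine ENNReal.tsum_le_tsum fun i => ?_
          have h1 : ∑' n, net.trafficMeasure {τ | Below τ b (m + i + 1) n}
              ≤ ENNReal.ofReal (6 * ((m + i + 1 : ℕ) : ℝ) ^ 2 / net.p b) :=
            tsum_below_le fun n => expectedBelow_le_sq hζ hζ' b h hκ (by omega)
              (hκm.trans (by exact_mod_cast (by omega : m ≤ m + i + 1))) n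
          refine (mul_le_mul_right h1 _).trans ?_
          rw [← ENNReal.ofReal_mul]
          · refine ENNReal.ofReal_le_ofReal ?_
            rw [← mul_div_assoc]
            exact div_le_div_of_nonneg_right (hterm i) hp.le
          · have : 0 ≤ 2 - 1 / (m : ℝ) := by linarith
            have h3 : (0 : ℝ) ≤ 2 - (2 - 1 / m) := by linarith
            positivity
      _ = ENNReal.ofReal (192 * A * (1 - 27 / 32)⁻¹ / net.p b) := by
          rw [← hgeo.tsum_eq, ENNReal.ofReal_tsum_of_nonneg (fun i => by positivity) hgeo.summable]
      _ ≤ ENNReal.ofReal (ε * (X / (2 * net.p b))) := by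
          refine ENNReal.ofReal_le_ofReal ?_
          rw [mul_div_assoc', div_le_div_iff₀ hp (by positivity)]
          -- The geometric series gives 2 · 192 · 32/5 = 2457.6, whence 2458.
          have : 192 * A * (1 - 27 / 32 : ℝ)⁻¹ * 2 ≤ ε * X := by
            refine le_trans ?_ hε
            norm_num
            nlinarith
          nlinarith
  have hsub : {c : net.Code k | ENNReal.ofReal ((1 / net.p b) * (k + X)) < avgCodingDelay c}
      ⊆ {c | ENNReal.ofReal (X / (2 * net.p b)) ≤ excess b m c} := by
    intro c hc
    by_contra hlt
    rw [Set.mem_ofPred_eq, not_le] at hlt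
    rw [Set.mem_ofPred_eq] at hc
    refine absurd hc (not_lt.2 ?_)
    refine (avgCodingDelay_le b m c).trans ((add_le_add hsum1 hlt.le).trans ?_)
    rw [← ENNReal.ofReal_add (by positivity) (by positivity)]
    refine ENNReal.ofReal_le_ofReal (le_of_eq ?_)
    field_simp
    ring
  have hXp : 0 < X / (2 * net.p b) := by positivity
  calc net.codeMeasure k {c | ENNReal.ofReal ((1 / net.p b) * (k + X)) < avgCodingDelay c}
      ≤ net.codeMeasure k {c | ENNReal.ofReal (X / (2 * net.p b)) ≤ excess b m c} :=
        measure_mono hsub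
    _ ≤ (∫⁻ c, excess b m c ∂net.codeMeasure k) / ENNReal.ofReal (X / (2 * net.p b)) :=
        meas_ge_le_lintegral_div (measurable_excess _ m).aemeasurable (by simpa using hXp)
          ENNReal.ofReal_ne_top
    _ ≤ ENNReal.ofReal (ε * (X / (2 * net.p b))) / ENNReal.ofReal (X / (2 * net.p b)) := by gcongr
    _ = ENNReal.ofReal ε := by
        rw [← ENNReal.ofReal_div_of_pos hXp, mul_div_assoc, div_self hXp.ne', mul_one]

end LineNetwork

namespace LineNetwork

/-! ### The gaps between the parameters -/

section Gap

variable (net : LineNetwork)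

theorem exists_eq_minParam : ∃ b, net.p b = net.minParam := by
  have : Nonempty (Fin net.L) := ⟨⟨0, net.L_pos⟩⟩
  exact exists_eq_ciInf_of_finite

theorem minParam_le (i : Fin net.L) : net.minParam ≤ net.p i :=
  ciInf_le (Set.finite_range _).bddBelow i

theorem minParam_pos : 0 < net.minParam := by
  obtain ⟨b, hb⟩ := net.exists_eq_minParam
  exact hb ▸ net.p_pos b

theorem gapRatio_nonneg : 0 ≤ net.gapRatio := ENNReal.toReal_nonneg

theorem gapRatio_le_one : net.gapRatio ≤ 1 := by
  simpa [gapRatio] using ENNReal.toReal_mono ENNReal.one_ne_top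
    (min_le_right (net.gammaE / ENNReal.ofReal net.minParam) 1)

theorem gapRatio_mul_minParam_le (i : ℕ) (h : i + 1 < net.L) :
    net.gapRatio * net.minParam
      ≤ |net.p ⟨i + 1, h⟩ - net.p ⟨i, Nat.lt_of_succ_lt h⟩| := by
  have hp := net.minParam_pos
  rw [← le_div_iff₀ hp]
  refine ENNReal.toReal_le_of_le_ofReal (by positivity) ((min_le_left _ _).trans ?_)
  rw [ENNReal.ofReal_div_of_pos hp]
  gcongr
  exact iInf₂_le i h

end Gap

/-- Up to a constant factor, the gap ratio bounds the relative distance between the smallest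
parameter and all others. -/
theorem exists_gap_const (net : ℕ → LineNetwork) (hne : ∀ k, Function.Injective (net k).p)
    (horder : (∀ k, StrictAnti (net k).p) ∨ ∃ net₀, ∀ k, net k = net₀) :
    ∃ c : ℝ, 0 < c ∧ c ≤ 1 ∧ ∀ k, ∃ b, (net k).p b = (net k).minParam ∧
      ∀ i, i ≠ b → (1 + c * (net k).gapRatio) * (net k).p b ≤ (net k).p i := by
  rcases horder with hanti | ⟨net₀, h₀⟩
  · refine ⟨1, one_pos, le_rfl, fun k => ?_⟩
    obtain ⟨b, hb⟩ := (net k).exists_eq_minParam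
    refine ⟨b, hb, fun i hi => ?_⟩
    have hlt : (net k).p b < (net k).p i :=
      lt_of_le_of_ne (hb ▸ (net k).minParam_le i) fun h => hi (hne k h).symm
    -- The minimum is at the end of the line, so p_i exceeds p_b by at least the one adjacent gap
    -- p_i - p_{i+1}.
    have hib : i < b := (hanti k).lt_iff_gt.1 hlt
    have hi1 : (i : ℕ) + 1 < (net k).L := lt_of_le_of_lt hib b.isLt
    have h1 := (net k).gapRatio_mul_minParam_le i hi1
    have h2 : (net k).p b ≤ (net k).p ⟨i + 1, hi1⟩ := (hanti k).antitone hib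
    have h3 : (net k).p ⟨i + 1, hi1⟩ ≤ (net k).p i :=
      (hanti k).antitone (Fin.le_def.2 (Nat.le_succ _))
    rw [abs_sub_comm, abs_of_nonneg (sub_nonneg.2 h3), ← hb] at h1
    have h4 : (net k).p ⟨i, Nat.lt_of_succ_lt hi1⟩ = (net k).p i := rfl
    linarith
  · have hinj : Function.Injective net₀.p := h₀ 0 ▸ hne 0
    obtain ⟨b, hb⟩ := net₀.exists_eq_minParam
    have hlt : ∀ i, i ≠ b → net₀.p b < net₀.p i := fun i hi =>
      lt_of_le_of_ne (hb ▸ net₀.minParam_le i) fun h => hi (hinj h).symm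
    have hpb := net₀.p_pos b
    obtain ⟨c, hc0, hc1, hc⟩ : ∃ c : ℝ, 0 < c ∧ c ≤ 1 ∧
        ∀ i, i ≠ b → (1 + c) * net₀.p b ≤ net₀.p i := by
      have : Nonempty (Fin net₀.L) := ⟨b⟩
      -- The least relative distance to p_b, capped at 1; the value 1 at b keeps b harmless in the
      -- minimum.
      obtain ⟨j, hj⟩ := Finite.exists_min fun i : Fin net₀.L =>
        if i = b then (1 : ℝ) else min 1 ((net₀.p i - net₀.p b) / net₀.p b)
      refine ⟨if j = b then (1 : ℝ) else min 1 ((net₀.p j - net₀.p b) / net₀.p b),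
        ?_, ?_, fun i hi => ?_⟩
      · split_ifs with h
        · exact one_pos
        · exact lt_min one_pos (div_pos (sub_pos.2 (hlt j h)) hpb)
      · split_ifs
        · exact le_rfl
        · exact min_le_left _ _
      · have h1 := (hj i).trans (le_of_eq (if_neg hi)) |>.trans (min_le_right _ _)
        rw [le_div_iff₀ hpb] at h1
        linarith
    refine ⟨c, hc0, hc1, fun k => ?_⟩
    rw [h₀ k]
    refine ⟨b, hb, fun i hi => le_trans ?_ (hc i hi)⟩
    have := mul_le_mul_of_nonneg_left net₀.gapRatio_le_one hc0.le
    gcongr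
    linarith

end LineNetwork

/-! ### Elementary estimates -/

theorem log_two_add_two_mul_le {w v : ℝ} (hw : 1 ≤ Real.log w) (hw0 : 1 ≤ w)
    (h : 2000 * (w * Real.log w) ≤ v) : 24 * (w * (Real.log (2 + 2 * v) + 4)) ≤ v := by
  have hw' : 0 < w := by linarith
  obtain ⟨z, rfl⟩ : ∃ z, v = w * z := ⟨v / w, (mul_div_cancel₀ v hw'.ne').symm⟩
  have hz : 2000 * Real.log w ≤ z := by
    have : w * (2000 * Real.log w) ≤ w * z := by linarith
    exact le_of_mul_le_mul_left this hw'
  have hz0 : 2000 ≤ z := by linarith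
  have hzpos : 0 < z := by linarith
  have h1 : Real.log (2 + 2 * (w * z)) ≤ Real.log (4 * (w * z)) := by
    refine Real.log_le_log (by positivity) ?_
    nlinarith
  have h2 : Real.log (4 * (w * z))
      = Real.log 4 + (Real.log w + (Real.log 100 + Real.log (z / 100))) := by
    rw [← Real.log_mul (by norm_num) (by positivity), mul_div_cancel₀ z (by norm_num),
      ← Real.log_mul hw'.ne' hzpos.ne', ← Real.log_mul (by norm_num) (by positivity)]
  have h3 : Real.log 4 ≤ 3 := by
    have := Real.log_le_sub_one_of_pos (show (0 : ℝ) < 4 by norm_num)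
    linarith
  have h4 : Real.log 100 ≤ 18 := by
    have e : Real.log 100 = 2 * Real.log 10 := by
      rw [show (100 : ℝ) = 10 ^ 2 by norm_num, Real.log_pow]; norm_num
    have := Real.log_le_sub_one_of_pos (show (0 : ℝ) < 10 by norm_num)
    linarith
  have h5 := Real.log_le_sub_one_of_pos (show 0 < z / 100 by positivity)
  have h6 : 24 * (Real.log (2 + 2 * (w * z)) + 4) ≤ z := by linarith
  calc 24 * (w * (Real.log (2 + 2 * (w * z)) + 4))
      = w * (24 * (Real.log (2 + 2 * (w * z)) + 4)) := by ring
    _ ≤ w * z := by gcongr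

theorem half_le_log_one_add {x : ℝ} (hx : 0 < x) (hx1 : x ≤ 1) : x / 2 ≤ Real.log (1 + x) := by
  have h := Real.one_sub_inv_le_log_of_pos (show 0 < 1 + x by linarith)
  refine le_trans ?_ h
  rw [← sub_nonneg]
  have : 1 - (1 + x)⁻¹ - x / 2 = x * (1 - x) / (2 * (1 + x)) := by field_simp; ring
  rw [this]
  exact div_nonneg (mul_nonneg hx.le (by linarith)) (by linarith)

/-- The surplus m - k gives 2^(m-k) ≥ (kL/ε)^(7L) ≥ k^(7L)/ε. Of the 7L powers of k, 6L absorb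
(2m)^(L+2) and L absorb the constant 2458. -/
theorem failure_bound_le {k L m : ℕ} {ε X : ℝ} (hk : 2458 ≤ k) (hL : 0 < L) (hε : 0 < ε)
    (hε1 : ε < 1) (hX : 1 ≤ X) (hm : k + X / 8 ≤ m) (hm2 : m ≤ 2 * (k : ℝ))
    (hXL : 7 * L * Real.logb 2 (k * L / ε) ≤ X / 8) :
    2458 * (2 ^ k * (2 * (m : ℝ)) ^ (L + 2) / 2 ^ m) ≤ ε * X := by
  have hk' : (2458 : ℝ) ≤ k := by exact_mod_cast hk
  have hL' : (1 : ℝ) ≤ L := by exact_mod_cast hL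
  have hk0 : (0 : ℝ) < k := by linarith
  have hkm : k ≤ m := by
    have : (k : ℝ) ≤ m := by linarith
    exact_mod_cast this
  have hQ : 0 < (k * L / ε : ℝ) := by positivity
  have h1 : (k * L / ε : ℝ) ^ (7 * L) ≤ 2 ^ (m - k) := by
    have e1 : (k * L / ε : ℝ) ^ (7 * L)
        = (2 : ℝ) ^ (7 * L * Real.logb 2 (k * L / ε) : ℝ) := by
      rw [mul_comm (7 * (L : ℝ)), Real.rpow_mul zero_le_two,
        Real.rpow_logb zero_lt_two (by norm_num) hQ, ← Real.rpow_natCast]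
      push_cast; rfl
    rw [e1, ← Real.rpow_natCast 2 (m - k)]
    refine Real.rpow_le_rpow_of_exponent_le one_le_two ?_
    rw [Nat.cast_sub hkm]
    linarith
  have h2 : (k : ℝ) ^ (7 * L) ≤ ε * (k * L / ε : ℝ) ^ (7 * L) := by
    have e : (k * L / ε : ℝ) = (k * L) * ε⁻¹ := div_eq_mul_inv _ _
    have h3 : (k : ℝ) ^ (7 * L) ≤ (k * L : ℝ) ^ (7 * L) := by
      gcongr; nlinarith
    have h4 : 1 ≤ ε * ε⁻¹ ^ (7 * L) := by
      have : ε⁻¹ ^ 1 ≤ ε⁻¹ ^ (7 * L) :=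
        pow_le_pow_right₀ (one_le_inv₀ hε |>.2 hε1.le) (by omega)
      calc 1 = ε * ε⁻¹ ^ 1 := by rw [pow_one, mul_inv_cancel₀ hε.ne']
        _ ≤ _ := by gcongr
    rw [e, mul_pow]
    have h5 : 0 ≤ (k * L : ℝ) ^ (7 * L) := by positivity
    nlinarith
  have h6 : (2 * (m : ℝ)) ^ (L + 2) ≤ (k : ℝ) ^ (6 * L) := by
    calc (2 * (m : ℝ)) ^ (L + 2) ≤ ((k : ℝ) ^ 2) ^ (L + 2) := by
          gcongr; nlinarith
      _ = (k : ℝ) ^ (2 * (L + 2)) := (pow_mul _ _ _).symm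
      _ ≤ (k : ℝ) ^ (6 * L) := pow_le_pow_right₀ (by linarith) (by omega)
  have h7 : (2458 : ℝ) ≤ (k : ℝ) ^ L :=
    hk'.trans (le_self_pow₀ (by linarith) hL.ne')
  have h8 : 2458 * (2 * (m : ℝ)) ^ (L + 2) ≤ (k : ℝ) ^ (7 * L) := by
    calc 2458 * (2 * (m : ℝ)) ^ (L + 2) ≤ (k : ℝ) ^ L * (k : ℝ) ^ (6 * L) := by gcongr
      _ = (k : ℝ) ^ (7 * L) := by rw [← pow_add]; congr 1; ring
  have h9 : (2 : ℝ) ^ k / 2 ^ m = (2 ^ (m - k))⁻¹ := by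
    rw [pow_sub₀ _ two_ne_zero hkm]; field_simp
  calc 2458 * (2 ^ k * (2 * (m : ℝ)) ^ (L + 2) / 2 ^ m)
      = 2458 * (2 * (m : ℝ)) ^ (L + 2) * (2 ^ k / 2 ^ m) := by ring
    _ ≤ (ε * 2 ^ (m - k)) * (2 ^ (m - k))⁻¹ := by
        rw [h9]
        exact mul_le_mul_of_nonneg_right
          (h8.trans (h2.trans (mul_le_mul_of_nonneg_left h1 hε.le))) (by positivity)
    _ = ε := by field_simp
    _ ≤ ε * X := le_mul_of_one_le_right hε.le hX

/-! ### Choice of parameters and passage to the limit -/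

namespace LineNetwork

/-- Non-asymptotic form of the main theorem. -/
theorem codeMeasure_avgCodingDelay_le_of_large {net : LineNetwork} {k : ℕ} {ε w f r : ℝ}
    (hε : 0 < ε) (hε1 : ε < 1) (b : Fin net.L) (hr : 0 < r) (hr1 : r ≤ 1)
    (hgap : ∀ i, i ≠ b → (1 + r) * net.p b ≤ net.p i) (hk : 2458 ≤ k) (hf : 112 ≤ f)
    (hw0 : 1 ≤ w) (hw : 1 ≤ Real.log w) (hrk : 2000 * (w * Real.log w) ≤ r * k)
    (hX₁ : f * Real.logb 2 (k * net.L / ε) * net.L / 2 ≤ k * net.L / w)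
    (hX₂ : k * net.L / w ≤ k) :
    net.codeMeasure k {c | ENNReal.ofReal ((1 / net.p b) * (k + k * net.L / w))
      < avgCodingDelay c} ≤ ENNReal.ofReal ε := by
  have hk' : (2458 : ℝ) ≤ k := by exact_mod_cast hk
  have hL : (1 : ℝ) ≤ net.L := by exact_mod_cast net.L_pos
  set X : ℝ := k * net.L / w with hXdef
  have hΛ : 1 ≤ Real.logb 2 (k * net.L / ε) := by
    rw [Real.le_logb_iff_rpow_le one_lt_two (by positivity), Real.rpow_one, le_div_iff₀ hε]
    nlinarith
  have hΛL : 1 ≤ Real.logb 2 (k * net.L / ε) * net.L := one_le_mul_of_one_le_of_one_le hΛ hL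
  have hXΛ : 56 * (Real.logb 2 (k * net.L / ε) * net.L) ≤ X := by nlinarith
  have hX8 : 8 ≤ X := by linarith
  -- The budget X/2 is shared: at most X/4 for the surplus m - k, and X/4 for the queueing loss.
  set m : ℕ := k + ⌈X / 8⌉₊ with hm
  have hm1 : k + X / 8 ≤ (m : ℝ) := by
    rw [hm]; push_cast; linarith [Nat.le_ceil (X / 8)]
  have hm2 : (m : ℝ) ≤ k + X / 4 := by
    rw [hm]; push_cast; linarith [Nat.ceil_lt_add_one (show 0 ≤ X / 8 by linarith)]
  -- ζ = 1 + r/3 respects the gap and has log ζ ≥ r/6, which gives κ = 6L/r.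
  have hζ2 : (1 + r / 3) ^ 2 ≤ 1 + r := by nlinarith
  have hζ1 : 0 ≤ (1 + r / 3) ^ 2 - 1 := by nlinarith
  set κ : ℝ := 6 * net.L / r with hκ
  have hκ0 : 0 < κ := by positivity
  have hlogζ := half_le_log_one_add (show 0 < r / 3 by linarith) (by linarith)
  have hκX : κ * (Real.log (2 + 2 * (r * k)) + 4) ≤ X / 4 := by
    have h := log_two_add_two_mul_le hw hw0 hrk
    rw [hκ, hXdef, div_mul_eq_mul_div, div_div, div_le_div_iff₀ hr (by positivity)]
    have := mul_le_mul_of_nonneg_left h (Nat.cast_nonneg (α := ℝ) net.L)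
    linarith
  have hu : Real.log (2 + ((1 + r / 3) ^ 2 - 1) * m) ≤ Real.log (2 + 2 * (r * k)) := by
    refine Real.log_le_log (by positivity) ?_
    have : ((1 + r / 3) ^ 2 - 1) * m ≤ r * (2 * k) := by
      gcongr
      · linarith
      · linarith
    linarith
  have hu0 : 0 ≤ Real.log (2 + ((1 + r / 3) ^ 2 - 1) * m) := by
    refine Real.log_nonneg ?_
    have : 0 ≤ ((1 + r / 3) ^ 2 - 1) * (m : ℝ) := by positivity
    linarith
  have hκu : κ * (Real.log (2 + ((1 + r / 3) ^ 2 - 1) * m) + 4) ≤ X / 4 :=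
    le_trans (by gcongr) hκX
  have hκu0 := mul_nonneg hκ0.le hu0
  refine codeMeasure_avgCodingDelay_le (ζ := 1 + r / 3) (κ := κ) (m := m) (by linarith)
    (by linarith) b (fun i hi => le_trans ?_ (hgap i hi)) ?_ (by omega) (by linarith)
    (by linarith) (by linarith) (by linarith) ?_
  · exact mul_le_mul_of_nonneg_right hζ2 (net.p_pos b).le
  · rw [hκ, div_le_div_iff₀ (by linarith) hr]
    nlinarith
  · exact failure_bound_le hk net.L_pos hε hε1 (by linarith) hm1 (by linarith) (by linarith)

end LineNetwork

theorem mainTheorem8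
    (net : ℕ → LineNetwork) (ε w f : ℕ → ℝ)
    (hε : ∀ k, 0 < ε k ∧ ε k < 1)
    -- unequal parameters
    (hne : ∀ k, Function.Injective (net k).p)
    -- either the parameters decrease along the line, or the network does not depend on `k`
    (horder : (∀ k, StrictAnti (net k).p) ∨ ∃ net₀, ∀ k, net k = net₀)
    (hf : Tendsto f atTop atTop)
    (hfo : f =o[atTop] fun k : ℕ =>
      (k : ℝ) / ((net k).L * Real.logb 2 (k * (net k).L / ε k)))
    (hw : w ~[atTop] fun k : ℕ => (k : ℝ) / (f k * Real.logb 2 (k * (net k).L / ε k)))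
    (hcond : (fun k : ℕ => w k * Real.logb 2 (w k * (net k).L / ε k)) =o[atTop]
      fun k : ℕ => (net k).gapRatio * (k : ℝ)) :
    ∃ η : ℕ → ℝ, Tendsto η atTop (𝓝 0) ∧
      ∀ᶠ k : ℕ in atTop,
        (net k).codeMeasure k
            {c | ENNReal.ofReal
                ((1 / (net k).minParam) * (k + (1 + η k) * (k * (net k).L / w k)))
              < LineNetwork.avgCodingDelay c}
          ≤ ENNReal.ofReal (ε k) := by
  refine ⟨fun _ => 0, tendsto_const_nhds, ?_⟩
  obtain ⟨c, hc0, hc1, hc⟩ := LineNetwork.exists_gap_const net hne horder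
  -- With g = k/(fΛ), where Λ is the logarithm in `hw`, the three constants yield 2000 w log w ≤ rk
  -- for r = c · `gapRatio`, then 16L ≤ g, and g/2 ≤ w ≤ 3g/2; hence also w ≥ 8L.
  have hcond' := hcond.def (show 0 < c / 2000 by positivity)
  have hfo' := hfo.def (show (0 : ℝ) < 1 / 16 by norm_num)
  have hw' := hw.isLittleO.def (show (0 : ℝ) < 1 / 2 by norm_num)
  filter_upwards [hcond', hfo', hw', hf.eventually_ge_atTop 112, eventually_ge_atTop 2458]
    with k h1 h2 h3 hfk hk
  obtain ⟨b, hb, hgap⟩ := hc k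
  obtain ⟨hε0, hε1⟩ := hε k
  have hk' : (2458 : ℝ) ≤ k := by exact_mod_cast hk
  have hL : (1 : ℝ) ≤ (net k).L := by exact_mod_cast (net k).L_pos
  have hr0 := (net k).gapRatio_nonneg
  set Λ := Real.logb 2 (k * (net k).L / ε k) with hΛdef
  have hΛ : 1 ≤ Λ := by
    rw [hΛdef, Real.le_logb_iff_rpow_le one_lt_two (by positivity), Real.rpow_one,
      le_div_iff₀ hε0]
    nlinarith
  have hfΛ : 0 < f k * Λ := by positivity
  set g : ℝ := k / (f k * Λ) with hg
  have hg0 : 0 < g := by positivity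
  rw [Real.norm_of_nonneg (by linarith), Real.norm_of_nonneg (by positivity)] at h2
  have hgL : 16 * (net k).L ≤ g := by
    rw [hg, le_div_iff₀ hfΛ]
    rw [mul_div_assoc', le_div_iff₀ (by positivity)] at h2
    linarith
  rw [Pi.sub_apply, Real.norm_of_nonneg hg0.le, Real.norm_eq_abs, abs_le] at h3
  have hw8 : 8 ≤ w k := by linarith
  have hlogw : 1 ≤ Real.log (w k) := by
    rw [Real.le_log_iff_exp_le (by linarith)]
    linarith [Real.exp_one_lt_d9]
  have hlogb : Real.log (w k) ≤ Real.logb 2 (w k * (net k).L / ε k) := by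
    have e1 : Real.log (w k) ≤ Real.log (w k * (net k).L / ε k) := by
      refine Real.log_le_log (by linarith) ?_
      rw [le_div_iff₀ hε0]
      nlinarith
    rw [Real.logb, le_div_iff₀ (Real.log_pos one_lt_two)]
    have := Real.log_two_lt_d9
    nlinarith
  have hrk : 2000 * (w k * Real.log (w k)) ≤ c * (net k).gapRatio * k := by
    have h4 : w k * Real.log (w k) ≤ w k * Real.logb 2 (w k * (net k).L / ε k) := by gcongr
    rw [Real.norm_of_nonneg (mul_nonneg (by linarith) (by linarith)),
      Real.norm_of_nonneg (by positivity)] at h1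
    linarith
  -- Positivity of the gap is read off from `hrk`, whose left side is positive.
  have hr : 0 < c * (net k).gapRatio := by
    have : 0 < c * (net k).gapRatio * k := lt_of_lt_of_le (by positivity) hrk
    exact pos_of_mul_pos_left this (by linarith)
  have hkg : (k : ℝ) = g * (f k * Λ) := by rw [hg]; field_simp
  have main := LineNetwork.codeMeasure_avgCodingDelay_le_of_large hε0 hε1 b hr
    (mul_le_one₀ hc1 hr0 (net k).gapRatio_le_one) hgap hk hfk (by linarith) hlogw hrk
    (by
      rw [← hΛdef, le_div_iff₀ (by linarith)]
      have h5 : w k ≤ 2 * g := by linarith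
      calc f k * Λ * (net k).L / 2 * w k ≤ f k * Λ * (net k).L / 2 * (2 * g) := by gcongr
        _ = k * (net k).L := by rw [hkg]; ring)
    (by
      rw [div_le_iff₀ (by linarith)]
      gcongr
      linarith)
  simpa [hb] using main
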